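/- \textbf{Definitions.} A (directed) temporal graph $\mathcal G=(V,\mathcal E,T)$ has a finite vertex set $V$, $n=|V|$, and a set $\mathcal E\subseteq\{(u,v,t): u,v\in V,\ u\ne v,\ t\in\{1,\dots,T\}\}$ of $M=|\mathcal E|$ transitions. A temporal walk is a nonempty sequence $W=(e_1,\dots,e_k)$ of transitions such that each $e_{i+1}$ starts at the vertex where $e_i$ ends and the time labels are non-decreasing. If $W$ starts in $s$ and its last transition is $(w,z,t)$, then $W$ is an $s$-$z$-walk and an $s$-$(z,t)$-walk. $W$ visits the vertex appearance $(v,t)$ if it contains a transition $(u,v,t)$. A cost function $c$ maps the temporal walks of $\mathcal G$ to $\mathbb R\cup\{\infty\}$. Let $c^*_s(v,t)$ be the minimum of $c$ over all $s$-$(v,t)$-walks ($\infty$ if there is none), and $c^*_s(v)=\min_{1\le t\le T}c^*_s(v,t)$. Let $\mathcal W^{(c)}$ be the set of all walks $W$ (from $s$ to $z$, for any $s,z\in V$) with $c(W)=c^*_s(z)<\infty$. The cost function is \emph{finite} if $\mathcal W^{(c)}$ is finite. It is \emph{prefix-compatible} if, for every $W\in\mathcal W^{(c)}$ from $s$ and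 every vertex appearance $(v,t)$ visited by $W$: (i) the prefix $P$ of $W$ up to the last visit of $(v,t)$ has $c(P)=c^*_s(v,t)$; (ii) for every $s$-$(v,t)$-walk $W'$ with $c(W')=c^*_s(v,t)$, the concatenation of $W'$ with the part of $W$ after its first visit of $(v,t)$ is in $\mathcal W^{(c)}$. For $s,z,v\in V$ let $\sigma_{sz}$ be the number of $s$-$z$-walks in $\mathcal W^{(c)}$ and $\sigma_{sz}(v)$ the number of those that go through $v$. The temporal betweenness centrality of $v$ is $$B(v)=\sum_{s,z\in V\setminus\{v\}}\delta_{sz}(v),\qquad \delta_{sz}(v)=\begin{cases}0&\text{if }\sigma_{sz}=0,\\ \sigma_{sz}(v)/\sigma_{sz}&\text{otherwise.}\end{cases}$$ \textbf{Theorem.} There is an algorithm which, given a temporal graph $\mathcal G$ (vertices numbered $0,\dots,n-1$, transitions listed in any order) and a finite, prefix-compatible cost function $c$ on $\mathcal G$ such that the minimum $c^*_s(v,t)$ is attained whenever an $s$-$(v,t)$-walk exists, computes $B(v)$ for all $v\in V$ in $O(n^2MT^2)$ time; precisely, in at most $K\,(n^2MT^2+1)$ steps for an absolute constant $K$. Here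 the model is a unit-cost random access machine with addition and subtraction on indices, exact rational arithmetic, comparison of costs, walks stored as linked lists that are extended by one transition in one step, and access to $c$ by an oracle that evaluates $c$ on a stored temporal walk in one step. -/

import Mathlib

/-! ## Temporal graphs and temporal walks -/

/-- A transition from `src` to `dst` at time step `time`. -/
@[ext] structure TimeArc (V : Type) where
  src : V
  dst : V
  time : ℕ

/-- A directed temporal graph `(V, arcs, lifetime)` with time steps `1, …, lifetime`. -/
structure TemporalGraph (V : Type) where
  lifetime : ℕ
  arcs : Finset (TimeArc V)
  src_ne_dst : ∀ e ∈ arcs, e.src ≠ e.dst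
  time_pos : ∀ e ∈ arcs, 1 ≤ e.time
  time_le : ∀ e ∈ arcs, e.time ≤ lifetime

namespace TemporalGraph

variable {V : Type}

/-- A temporal walk: a nonempty sequence of transitions, each starting where the previous one
ended, with non-decreasing time labels. -/
@[ext] structure Walk (G : TemporalGraph V) where
  arcs : List (TimeArc V)
  ne_nil : arcs ≠ []
  mem_arcs : ∀ e ∈ arcs, e ∈ G.arcs
  chain : arcs.IsChain (fun e f => e.dst = f.src ∧ e.time ≤ f.time)

namespace Walk

variable {G : TemporalGraph V}

/-- The vertex where the walk starts. -/
def source (W : G.Walk) : V := (W.arcs.head W.ne_nil).src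

/-- The vertex where the walk ends. -/
def target (W : G.Walk) : V := (W.arcs.getLast W.ne_nil).dst

/-- The time label of the last transition. -/
def arrival (W : G.Walk) : ℕ := (W.arcs.getLast W.ne_nil).time

/-- `W` is an `s`-`z`-walk. -/
def IsFromTo (W : G.Walk) (s z : V) : Prop := W.source = s ∧ W.target = z

/-- `W` is an `s`-`(v, t)`-walk. -/
def IsFromToAt (W : G.Walk) (s v : V) (t : ℕ) : Prop :=
  W.source = s ∧ W.target = v ∧ W.arrival = t

/-- `W` goes through the vertex `v` (possibly as its first or last vertex). -/
def GoesThrough (W : G.Walk) (v : V) : Prop := W.source = v ∨ ∃ e ∈ W.arcs, e.dst = v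

end Walk

/-- The sequence of transitions `l` visits the vertex appearance `(v, t)`. -/
def Visits (l : List (TimeArc V)) (v : V) (t : ℕ) : Prop := ∃ e ∈ l, e.dst = v ∧ e.time = t

/-! ## Cost functions and optimal walks -/

/-- A cost function assigns a real number or `∞` to every temporal walk. -/
abbrev CostFunction (G : TemporalGraph V) : Type := G.Walk → WithTop ℝ

namespace CostFunction

variable {G : TemporalGraph V}

/-- `W` is an `s`-`(v, t)`-walk of minimum cost among all `s`-`(v, t)`-walks. -/
def IsMinAt (c : CostFunction G) (s v : V) (t : ℕ) (W : G.Walk) : Prop :=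
  W.IsFromToAt s v t ∧ ∀ W' : G.Walk, W'.IsFromToAt s v t → c W ≤ c W'

open Classical in
/-- The minimum cost of an `s`-`(v, t)`-walk, and `∞` if there is no such minimum. -/
noncomputable def optAt (c : CostFunction G) (s v : V) (t : ℕ) : WithTop ℝ :=
  if h : ∃ W, c.IsMinAt s v t W then c h.choose else ⊤

/-- The minimum of `optAt c s v t` over all time steps `t`. -/
noncomputable def optTo (c : CostFunction G) (s v : V) : WithTop ℝ :=
  (Finset.Icc 1 G.lifetime).inf (fun t => c.optAt s v t)

/-- The induced set of optimal temporal walks. -/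
def optimalWalks (c : CostFunction G) : Set G.Walk :=
  {W | c W < ⊤ ∧ c W = c.optTo W.source W.target}

/-- The cost function is finite: there are only finitely many optimal walks. -/
def IsFinite (c : CostFunction G) : Prop := c.optimalWalks.Finite

/-- Whenever there is an `s`-`(v, t)`-walk, there is one of minimum cost. -/
def HasMinima (c : CostFunction G) : Prop :=
  ∀ (s v : V) (t : ℕ), (∃ W : G.Walk, W.IsFromToAt s v t) → ∃ W, c.IsMinAt s v t W

/-- For every optimal walk `W` and every vertex appearance `(v, t)` on it, the prefix `P` of `W`
up to the last visit of `(v, t)` has cost `optAt c s v t`, where `s` is the source of `W`. -/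
def PrefixOptimal (c : CostFunction G) : Prop :=
  ∀ W ∈ c.optimalWalks, ∀ (v : V) (t : ℕ) (P : G.Walk) (S : List (TimeArc V)),
    W.arcs = P.arcs ++ S → P.target = v → P.arrival = t → ¬ Visits S v t →
      c P = c.optAt W.source v t

/-- For every optimal walk `W` and every vertex appearance `(v, t)` on it, let `S` be the suffix
of `W` that starts at the first visit of `(v, t)`, so `W = P ⊕ S`, where `(v, t)` is the end of `P`
and is not visited earlier by `P`. Then `W' ⊕ S` is an optimal walk for every
`s`-`(v, t)`-walk `W'` of cost `optAt c s v t`, where `s` is the source of `W`. -/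
def PrefixExchangeable (c : CostFunction G) : Prop :=
  ∀ W ∈ c.optimalWalks, ∀ (v : V) (t : ℕ) (P : G.Walk) (S : List (TimeArc V)),
    W.arcs = P.arcs ++ S → P.target = v → P.arrival = t → ¬ Visits P.arcs.dropLast v t →
      ∀ W' : G.Walk, W'.IsFromToAt W.source v t → c W' = c.optAt W.source v t →
        ∃ X ∈ c.optimalWalks, X.arcs = W'.arcs ++ S

/-- Prefix-compatibility. -/
def PrefixCompatible (c : CostFunction G) : Prop := c.PrefixOptimal ∧ c.PrefixExchangeable

end CostFunction

/-! ## Temporal betweenness centrality -/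

section Betweenness

variable {G : TemporalGraph V}

/-- The number of `s`-`z`-walks in `𝒲`. -/
noncomputable def walkCount (𝒲 : Set G.Walk) (s z : V) : ℕ :=
  Set.ncard {W | W ∈ 𝒲 ∧ W.IsFromTo s z}

/-- The number of `s`-`z`-walks in `𝒲` that go through the vertex `v`. -/
noncomputable def walkCountThrough (𝒲 : Set G.Walk) (s z v : V) : ℕ :=
  Set.ncard {W | W ∈ 𝒲 ∧ W.IsFromTo s z ∧ W.GoesThrough v}

/-- The pair dependency of `s` and `z` on `v`. -/
noncomputable def pairDependency (𝒲 : Set G.Walk) (s z v : V) : ℚ :=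
  if walkCount 𝒲 s z = 0 then 0 else (walkCountThrough 𝒲 s z v : ℚ) / (walkCount 𝒲 s z : ℚ)

open Classical in
/-- The temporal betweenness centrality of `v` with respect to `𝒲`: the sum of the pair
dependencies over all `s, z` that are both different from `v`. -/
noncomputable def betweenness [Fintype V] (𝒲 : Set G.Walk) (v : V) : ℚ :=
  ∑ s : V, ∑ z : V, if s ≠ v ∧ v ≠ z then pairDependency 𝒲 s z v else 0

end Betweenness

end TemporalGraph

/-! ## A random access machine with a cost oracle

Programs of a small imperative language over arrays, with unit-cost steps. There are four sorts of
arrays, each array being named by a natural number and having cells `0, 1, 2, …`: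
* index arrays hold natural numbers (used for control flow and addresses),
* number arrays hold rational numbers, on which there is exact arithmetic,
* cost arrays hold values in `ℝ ∪ {∞}`, which can only be copied and compared,
* walk arrays hold sequences of transitions, in the manner of pointers to linked lists whose nodes
  are never modified: such a cell can be copied, can be set to another cell extended by
  one transition, and can be handed to the cost oracle, and that is all.
A program is a finite object that does not depend on the input. -/

namespace RAM

/-- Index expressions. -/
inductive IdxExpr : Type where
  | lit (k : ℕ)
  | get (a : ℕ) (i : IdxExpr)
  | add (x y : IdxExpr)
  | sub (x y : IdxExpr)

/-- Numerical expressions. -/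
inductive NumExpr : Type where
  | lit (q : ℚ)
  | get (a : ℕ) (i : IdxExpr)
  | add (x y : NumExpr)
  | sub (x y : NumExpr)
  | mul (x y : NumExpr)
  | div (x y : NumExpr)

/-- Tests: `lt x y` compares two indices, `costLt a i b j` compares the cells `i` and `j` of the
cost arrays `a` and `b`. -/
inductive Test : Type where
  | lt (x y : IdxExpr)
  | costLt (a : ℕ) (i : IdxExpr) (b : ℕ) (j : IdxExpr)
  | not (p : Test)
  | and (p q : Test)

/-- Programs. -/
inductive Prog : Type where
  | skip
  /-- index array `a`, cell `i`, gets the value of `x` -/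
  | setIdx (a : ℕ) (i x : IdxExpr)
  /-- number array `a`, cell `i`, gets the value of `x` -/
  | setNum (a : ℕ) (i : IdxExpr) (x : NumExpr)
  /-- cost array `a`, cell `i`, gets a copy of cost array `b`, cell `j` -/
  | copyCost (a : ℕ) (i : IdxExpr) (b : ℕ) (j : IdxExpr)
  /-- walk array `a`, cell `i`, gets a copy of walk array `b`, cell `j` -/
  | copyWalk (a : ℕ) (i : IdxExpr) (b : ℕ) (j : IdxExpr)
  /-- walk array `a`, cell `i`, gets walk array `b`, cell `j`, extended at its end by the `k`-th
  input transition -/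
  | extendWalk (a : ℕ) (i : IdxExpr) (b : ℕ) (j k : IdxExpr)
  /-- cost array `a`, cell `i`, gets the cost of the walk in walk array `b`, cell `j` -/
  | query (a : ℕ) (i : IdxExpr) (b : ℕ) (j : IdxExpr)
  | seq (p q : Prog)
  | ite (b : Test) (p q : Prog)
  | while (b : Test) (p : Prog)

/-- Memory contents; `A` is the type of transitions. -/
structure State (A : Type) where
  idx : ℕ → ℕ → ℕ
  num : ℕ → ℕ → ℚ
  cost : ℕ → ℕ → WithTop ℝ
  walk : ℕ → ℕ → List A

/-- The memory `m` with cell `i` of array `a` overwritten by `x`. -/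
def write {α : Type} (m : ℕ → ℕ → α) (a i : ℕ) (x : α) : ℕ → ℕ → α :=
  Function.update m a (Function.update (m a) i x)

section Semantics

variable {A : Type}

/-- The value of an index expression (`sub` is truncated subtraction). -/
def IdxExpr.eval (σ : State A) : IdxExpr → ℕ
  | .lit k => k
  | .get a i => σ.idx a (i.eval σ)
  | .add x y => x.eval σ + y.eval σ
  | .sub x y => x.eval σ - y.eval σ

/-- The value of a numerical expression. -/
def NumExpr.eval (σ : State A) : NumExpr → ℚ
  | .lit q => q
  | .get a i => σ.num a (i.eval σ)
  | .add x y => x.eval σ + y.eval σ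
  | .sub x y => x.eval σ - y.eval σ
  | .mul x y => x.eval σ * y.eval σ
  | .div x y => x.eval σ / y.eval σ

/-- The outcome of a test. -/
def Test.Holds (σ : State A) : Test → Prop
  | .lt x y => x.eval σ < y.eval σ
  | .costLt a i b j => σ.cost a (i.eval σ) < σ.cost b (j.eval σ)
  | .not p => ¬ p.Holds σ
  | .and p q => p.Holds σ ∧ q.Holds σ

/-- `Run input oracle p σ k σ'`: started in memory `σ`, the program `p` halts in memory `σ'` after
exactly `k` steps. Here `input` is the list of transitions of the input and `oracle l x` says that
`l` is a walk of cost `x`; a query about a sequence that is not a walk, or an extension by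
a transition that does not exist, never halts. Every elementary command and every evaluation of
a test is one step (the expressions in it have constant size, as the program is fixed). -/
inductive Run (input : List A) (oracle : List A → WithTop ℝ → Prop) :
    Prog → State A → ℕ → State A → Prop where
  | skip (σ) : Run input oracle .skip σ 1 σ
  | setIdx (σ a i x) : Run input oracle (.setIdx a i x) σ 1
      { σ with idx := write σ.idx a (i.eval σ) (x.eval σ) }
  | setNum (σ a i x) : Run input oracle (.setNum a i x) σ 1
      { σ with num := write σ.num a (i.eval σ) (x.eval σ) }
  | copyCost (σ a i b j) : Run input oracle (.copyCost a i b j) σ 1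
      { σ with cost := write σ.cost a (i.eval σ) (σ.cost b (j.eval σ)) }
  | copyWalk (σ a i b j) : Run input oracle (.copyWalk a i b j) σ 1
      { σ with walk := write σ.walk a (i.eval σ) (σ.walk b (j.eval σ)) }
  | extendWalk (σ a i b j k e) (h : input[k.eval σ]? = some e) :
      Run input oracle (.extendWalk a i b j k) σ 1
        { σ with walk := write σ.walk a (i.eval σ) (σ.walk b (j.eval σ) ++ [e]) }
  | query (σ a i b j x) (h : oracle (σ.walk b (j.eval σ)) x) :
      Run input oracle (.query a i b j) σ 1 { σ with cost := write σ.cost a (i.eval σ) x }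
  | seq {σ₁ σ₂ σ₃ p q k l} (hp : Run input oracle p σ₁ k σ₂) (hq : Run input oracle q σ₂ l σ₃) :
      Run input oracle (.seq p q) σ₁ (k + l) σ₃
  | iteTrue {σ₁ σ₂ b p q k} (hb : b.Holds σ₁) (hp : Run input oracle p σ₁ k σ₂) :
      Run input oracle (.ite b p q) σ₁ (k + 1) σ₂
  | iteFalse {σ₁ σ₂ b p q k} (hb : ¬ b.Holds σ₁) (hq : Run input oracle q σ₁ k σ₂) :
      Run input oracle (.ite b p q) σ₁ (k + 1) σ₂
  | whileFalse {σ b p} (hb : ¬ b.Holds σ) : Run input oracle (.while b p) σ 1 σ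
  | whileTrue {σ₁ σ₂ σ₃ b p k l} (hb : b.Holds σ₁) (hp : Run input oracle p σ₁ k σ₂)
      (hw : Run input oracle (.while b p) σ₂ l σ₃) :
      Run input oracle (.while b p) σ₁ (k + l + 1) σ₃

end Semantics

/-- The initial memory for a temporal graph with vertices `0, …, n - 1` and lifetime `T` whose
transitions are listed in `input`. Index array `0` starts with `n`, the number of transitions, and
`T`; the cells `i` of the index arrays `1`, `2`, `3` hold the source, the destination and the time
label of the `i`-th transition. All other index and number cells are `0`, all cost cells are `∞`,
all walk cells hold the empty sequence. -/
def initialState (n T : ℕ) (input : List (TimeArc (Fin n))) : State (TimeArc (Fin n)) where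
  idx a i :=
    match a with
    | 0 => [n, input.length, T].getD i 0
    | 1 => (input.map (fun e => (e.src : ℕ))).getD i 0
    | 2 => (input.map (fun e => (e.dst : ℕ))).getD i 0
    | 3 => (input.map (fun e => e.time)).getD i 0
    | _ => 0
  num _ _ := 0
  cost _ _ := ⊤
  walk _ _ := []

end RAM

/-- The oracle that evaluates the cost function `c` on temporal walks. -/
def TemporalGraph.CostFunction.oracle {V : Type} {G : TemporalGraph V} (c : G.CostFunction)
    (l : List (TimeArc V)) (x : WithTop ℝ) : Prop :=
  ∃ W : G.Walk, W.arcs = l ∧ c W = x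

/-!
For a fixed source `s`, a vertex appearance is *good* if it lies on an optimal walk from `s`; the
empty walk is treated as a walk to the extra appearance `(s, 0)`.

*Structure of optimal walks.* An optimal walk that visited a vertex appearance twice could be pumped
(`exists_longer_of_repetition`), so by finiteness there are no repetitions. Hence the first and the
last visit coincide, and prefix-compatibility says that each prefix of an optimal walk has minimum
cost (`isMin_prefix`) and can be exchanged for any other walk of minimum cost to the same appearance
(`optimal_exchange`). So the walks of minimum cost to good appearances are exactly the paths of a
finite acyclic graph of *tight* steps, and they have fewer than `n (T + 1)` transitions.

*Computing the graph.* Relaxing all pairs of a transition and an arrival time `n (T + 1)` times, as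
in the algorithm of Bellman and Ford, finds a walk of minimum cost to every good appearance
(`Table.Round`). Nothing is claimed about the other appearances, but no tight step leads from one
of them to a good one. Ties are broken in favour of longer walks, so that the stored length is the
length of a longest path, and listing the tight steps by the length at their tail gives a
topological order (`Table.Enumerates`).

*Counting.* Along this order, one pass per vertex `v` counts the walks of minimum cost that avoid
`v` (`foldl_push`). Counting walks that avoid `v` rather than walks through `v` matters, since a walk
may visit `v` at several times. The optimal walks from `s` to `z` are the walks of minimum cost to
certain appearances of `z`, and splitting them by their last step turns the contribution of `s` to
the betweenness of `v` into one sum over the tight steps (`sum_pairDependency`).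

*Time.* The relaxation and the listing take `O(n T · M T)` steps per source, a counting pass takes
`O(M T)` steps per source and vertex, which gives `O(n² M T²)` in total.

The program is verified with triples that bound the running time (`Halts`), together with a
syntactic frame rule (`Frame`): a program changes only the arrays that it writes.
-/

/-! ### A program logic for the random access machine -/

namespace RAM

/-- The four sorts of arrays. -/
inductive Bank : Type where
  | idx
  | num
  | cost
  | walk

/-- Whether the program contains a command that writes into the array `a` of the given sort. -/
def Prog.writes : Bank → ℕ → Prog → Bool
  | .idx, a, .setIdx b _ _ => a == b
  | .num, a, .setNum b _ _ => a == b
  | .cost, a, .copyCost b _ _ _ => a == b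
  | .cost, a, .query b _ _ _ => a == b
  | .walk, a, .copyWalk b _ _ _ => a == b
  | .walk, a, .extendWalk b _ _ _ _ => a == b
  | s, a, .seq p q => p.writes s a || q.writes s a
  | s, a, .ite _ p q => p.writes s a || q.writes s a
  | s, a, .while _ p => p.writes s a
  | _, _, _ => false

/-- The memory `τ` agrees with `σ` on all arrays that `p` does not write. Whether a given program
writes a given array is a decidable, syntactic question. -/
structure Frame {A : Type} (p : Prog) (σ τ : State A) : Prop where
  idx : ∀ a, p.writes .idx a = false → τ.idx a = σ.idx a
  num : ∀ a, p.writes .num a = false → τ.num a = σ.num a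
  cost : ∀ a, p.writes .cost a = false → τ.cost a = σ.cost a
  walk : ∀ a, p.writes .walk a = false → τ.walk a = σ.walk a

theorem write_apply {α : Type} (m : ℕ → ℕ → α) (a i : ℕ) (x : α) (b : ℕ) :
    write m a i x b = if b = a then Function.update (m a) i x else m b := by
  unfold write
  by_cases h : b = a
  · subst h; simp
  · simp [h]

section

variable {A : Type} {input : List A} {oracle : List A → WithTop ℝ → Prop}

theorem Frame.refl (p : Prog) (σ : State A) : Frame p σ σ :=
  ⟨fun _ _ => rfl, fun _ _ => rfl, fun _ _ => rfl, fun _ _ => rfl⟩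

theorem Frame.trans {p : Prog} {σ τ ρ : State A} (h : Frame p σ τ) (h' : Frame p τ ρ) :
    Frame p σ ρ :=
  ⟨fun a ha => (h'.idx a ha).trans (h.idx a ha), fun a ha => (h'.num a ha).trans (h.num a ha),
    fun a ha => (h'.cost a ha).trans (h.cost a ha), fun a ha => (h'.walk a ha).trans (h.walk a ha)⟩

theorem Frame.of_writes_le {p q : Prog} {σ τ : State A} (h : Frame p σ τ)
    (hpq : ∀ s a, q.writes s a = false → p.writes s a = false) : Frame q σ τ :=
  ⟨fun a ha => h.idx a (hpq _ a ha), fun a ha => h.num a (hpq _ a ha),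
    fun a ha => h.cost a (hpq _ a ha), fun a ha => h.walk a (hpq _ a ha)⟩

theorem Run.frame {p : Prog} {σ τ : State A} {k : ℕ} (h : Run input oracle p σ k τ) :
    Frame p σ τ := by
  induction h with
  | skip σ => exact .refl _ _
  | setIdx | setNum | copyCost | copyWalk | extendWalk | query =>
    constructor <;> intro a ha <;> simp_all [Prog.writes, write_apply]
  | seq _ _ ih ih' =>
    exact (ih.of_writes_le (by simp +contextual [Prog.writes])).trans
      (ih'.of_writes_le (by simp +contextual [Prog.writes]))
  | iteTrue _ _ ih => exact ih.of_writes_le (by simp +contextual [Prog.writes])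
  | iteFalse _ _ ih => exact ih.of_writes_le (by simp +contextual [Prog.writes])
  | whileFalse => exact .refl _ _
  | whileTrue _ _ _ ih ih' => exact (ih.of_writes_le (by simp [Prog.writes])).trans ih'

variable (input oracle) in
/-- Total correctness with a time bound: started in `σ`, the program `p` halts after at most `k`
steps in a memory that satisfies `Q`. -/
def Halts (p : Prog) (k : ℕ) (Q : State A → Prop) (σ : State A) : Prop :=
  ∃ l ≤ k, ∃ τ, Run input oracle p σ l τ ∧ Q τ

variable {p q : Prog} {k l : ℕ} {σ : State A} {Q R : State A → Prop}

theorem Halts.mono (h : Halts input oracle p k Q σ) (hkl : k ≤ l)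
    (hQ : ∀ τ, Frame p σ τ → Q τ → R τ) : Halts input oracle p l R σ := by
  obtain ⟨m, hm, τ, hr, hq⟩ := h
  exact ⟨m, hm.trans hkl, τ, hr, hQ τ hr.frame hq⟩

theorem Halts.le (hkl : k ≤ l) (h : Halts input oracle p k Q σ) : Halts input oracle p l Q σ :=
  h.mono hkl fun _ _ => id

theorem Halts.skip (h : Q σ) : Halts input oracle .skip 1 Q σ := ⟨1, le_rfl, _, .skip _, h⟩

theorem Halts.setIdx {a : ℕ} {i x : IdxExpr}
    (h : Q { σ with idx := write σ.idx a (i.eval σ) (x.eval σ) }) :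
    Halts input oracle (.setIdx a i x) 1 Q σ := ⟨1, le_rfl, _, .setIdx _ _ _ _, h⟩

theorem Halts.setNum {a : ℕ} {i : IdxExpr} {x : NumExpr}
    (h : Q { σ with num := write σ.num a (i.eval σ) (x.eval σ) }) :
    Halts input oracle (.setNum a i x) 1 Q σ := ⟨1, le_rfl, _, .setNum _ _ _ _, h⟩

theorem Halts.copyCost {a b : ℕ} {i j : IdxExpr}
    (h : Q { σ with cost := write σ.cost a (i.eval σ) (σ.cost b (j.eval σ)) }) :
    Halts input oracle (.copyCost a i b j) 1 Q σ := ⟨1, le_rfl, _, .copyCost _ _ _ _ _, h⟩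

theorem Halts.copyWalk {a b : ℕ} {i j : IdxExpr}
    (h : Q { σ with walk := write σ.walk a (i.eval σ) (σ.walk b (j.eval σ)) }) :
    Halts input oracle (.copyWalk a i b j) 1 Q σ := ⟨1, le_rfl, _, .copyWalk _ _ _ _ _, h⟩

theorem Halts.extendWalk {a b : ℕ} {i j m : IdxExpr} (e : A) (he : input[m.eval σ]? = some e)
    (h : Q { σ with walk := write σ.walk a (i.eval σ) (σ.walk b (j.eval σ) ++ [e]) }) :
    Halts input oracle (.extendWalk a i b j m) 1 Q σ :=
  ⟨1, le_rfl, _, .extendWalk _ _ _ _ _ _ _ he, h⟩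

theorem Halts.query {a b : ℕ} {i j : IdxExpr} (x : WithTop ℝ)
    (hx : oracle (σ.walk b (j.eval σ)) x)
    (h : Q { σ with cost := write σ.cost a (i.eval σ) x }) :
    Halts input oracle (.query a i b j) 1 Q σ := ⟨1, le_rfl, _, .query _ _ _ _ _ _ hx, h⟩

theorem Halts.seq (h : Halts input oracle p k (Halts input oracle q l Q) σ) :
    Halts input oracle (.seq p q) (k + l) Q σ := by
  obtain ⟨m, hm, τ, hr, m', hm', ρ, hr', hq⟩ := h
  exact ⟨m + m', by omega, ρ, .seq hr hr', hq⟩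

theorem Halts.ite {b : Test} (ht : b.Holds σ → Halts input oracle p k Q σ)
    (hf : ¬ b.Holds σ → Halts input oracle q l Q σ) :
    Halts input oracle (.ite b p q) (max k l + 1) Q σ := by
  by_cases hb : b.Holds σ
  · obtain ⟨m, hm, τ, hr, hq⟩ := ht hb
    exact ⟨m + 1, by omega, τ, .iteTrue hb hr, hq⟩
  · obtain ⟨m, hm, τ, hr, hq⟩ := hf hb
    exact ⟨m + 1, by omega, τ, .iteFalse hb hr, hq⟩

end

/-- The scalar variable held in cell `0` of the index array `a`. -/
abbrev IdxExpr.var (a : ℕ) : IdxExpr := .get a (.lit 0)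

/-- Run `p` with the scalar variable `a` taking the values `0, 1, …` below `bound`. -/
def Prog.for (a : ℕ) (bound : IdxExpr) (p : Prog) : Prog :=
  .seq (.setIdx a (.lit 0) (.lit 0))
    (.while (.lt (.var a) bound) (.seq p (.setIdx a (.lit 0) (.add (.var a) (.lit 1)))))

/-- The memory `σ` with the scalar variable `a` set to `x`. -/
def State.setVar {A : Type} (σ : State A) (a x : ℕ) : State A :=
  { σ with idx := write σ.idx a 0 x }

section

variable {A : Type} {input : List A} {oracle : List A → WithTop ℝ → Prop}

theorem State.setVar_idx (σ : State A) (a x b : ℕ) :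
    (σ.setVar a x).idx b = if b = a then Function.update (σ.idx a) 0 x else σ.idx b :=
  write_apply _ _ _ _ _

theorem State.setVar_idx_of_ne (σ : State A) (a x b : ℕ) (h : b ≠ a) :
    (σ.setVar a x).idx b = σ.idx b := by
  rw [State.setVar_idx, if_neg h]

theorem State.setVar_num (σ : State A) (a x : ℕ) : (σ.setVar a x).num = σ.num := rfl

theorem Prog.writes_for (s : Bank) (a b : ℕ) (bound : IdxExpr) (p : Prog)
    (h : (Prog.for b bound p).writes s a = false) : p.writes s a = false := by
  cases s <;> simp_all [Prog.for, Prog.writes]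

theorem Prog.ne_of_writes_for (a b : ℕ) (bound : IdxExpr) (p : Prog)
    (h : (Prog.for b bound p).writes .idx a = false) : a ≠ b := by
  simp_all [Prog.for, Prog.writes]

theorem Frame.setVar {p : Prog} {σ τ : State A} {a : ℕ} {bound : IdxExpr} {x : ℕ}
    (h : Frame (Prog.for a bound p) σ τ) :
    Frame (Prog.for a bound p) σ (τ.setVar a x) :=
  ⟨fun b hb => by
    rw [State.setVar_idx, if_neg (Prog.ne_of_writes_for _ _ _ _ hb), h.idx b hb],
    h.num, h.cost, h.walk⟩

/-- The invariant rule for bounded loops. The invariant only has to speak about the arrays that the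
loop changes, since `Frame` keeps track of all the others. -/
theorem Halts.for {p : Prog} {a : ℕ} {bound : IdxExpr} {k N : ℕ} {σ : State A}
    {Q : State A → Prop} (I : ℕ → State A → Prop)
    (ha : p.writes .idx a = false)
    (hb : ∀ τ, Frame (Prog.for a bound p) σ τ → bound.eval τ = N)
    (h0 : I 0 (σ.setVar a 0))
    (hs : ∀ i < N, ∀ τ, Frame (Prog.for a bound p) σ τ → τ.idx a 0 = i → I i τ →
      Halts input oracle p k (fun τ' => I (i + 1) (τ'.setVar a (i + 1))) τ)
    (hQ : ∀ τ, Frame (Prog.for a bound p) σ τ → I N τ → Q τ) :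
    Halts input oracle (Prog.for a bound p) (N * (k + 2) + 2) Q σ := by
  -- `m` is the number of iterations that remain
  have key : ∀ m i τ, i + m = N → Frame (Prog.for a bound p) σ τ → τ.idx a 0 = i → I i τ →
      Halts input oracle (.while (.lt (.var a) bound)
        (.seq p (.setIdx a (.lit 0) (.add (.var a) (.lit 1))))) (m * (k + 2) + 1) Q τ := by
    intro m
    induction m with
    | zero =>
      intro i τ hi hF hc hI
      obtain rfl : i = N := by omega
      refine ⟨1, by omega, τ, .whileFalse ?_, hQ τ hF hI⟩
      simp [Test.Holds, hb τ hF, IdxExpr.eval, hc]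
    | succ m ih =>
      intro i τ hi hF hc hI
      obtain ⟨l, hl, τ', hr, hI'⟩ := hs i (by omega) τ hF hc hI
      have hc' : τ'.idx a 0 = i := by rw [hr.frame.idx a ha, hc]
      have hF' : Frame (Prog.for a bound p) σ τ' :=
        hF.trans (hr.frame.of_writes_le fun s b h => Prog.writes_for s b _ _ _ h)
      obtain ⟨l', hl', ρ, hr', hq⟩ := ih (i + 1) (τ'.setVar a (i + 1)) (by omega) hF'.setVar
        (by simp [State.setVar_idx]) hI'
      have hstep : Run input oracle (.setIdx a (.lit 0) (.add (.var a) (.lit 1))) τ' 1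
          (τ'.setVar a (i + 1)) := by
        have := @Run.setIdx A input oracle τ' a (.lit 0) (.add (.var a) (.lit 1))
        simpa [IdxExpr.eval, hc', State.setVar] using this
      refine ⟨l + 1 + l' + 1, ?_, ρ, .whileTrue ?_ (.seq hr hstep) hr', hq⟩
      · rw [Nat.succ_mul]; omega
      · simp [Test.Holds, hb τ hF, IdxExpr.eval, hc]; omega
  obtain ⟨l, hl, ρ, hr, hq⟩ := key N 0 (σ.setVar a 0) (by omega) (Frame.refl _ _).setVar
    (by simp [State.setVar_idx]) h0
  exact ⟨1 + l, by omega, ρ, .seq (.setIdx _ _ _ _) hr, hq⟩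

end

end RAM

/-! ### Walks as lists of transitions -/

namespace TemporalGraph

variable {n : ℕ}

/-- The number that encodes the vertex appearance `(v, t)`; the encoding is injective for
`0 ≤ t ≤ G.lifetime`. No transition arrives at time `0`, and `G.node s 0` encodes the start of
the walks from `s`. -/
def node (G : TemporalGraph (Fin n)) (v t : ℕ) : ℕ := v * (G.lifetime + 1) + t

/-- The vertex appearance that a walk visits with the transition `e`. -/
def head (G : TemporalGraph (Fin n)) (e : TimeArc (Fin n)) : ℕ := G.node e.dst e.time

/-- The vertex appearance at which a walk that arrived at time `p.2` stands before it takes the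
transition `p.1`. -/
def tail (G : TemporalGraph (Fin n)) (p : TimeArc (Fin n) × ℕ) : ℕ := G.node p.1.src p.2

/-- The pairs of a transition and an arrival time that is not too late for it. -/
def steps (G : TemporalGraph (Fin n)) : Set (TimeArc (Fin n) × ℕ) :=
  {p | p.1 ∈ G.arcs ∧ p.2 ≤ p.1.time}

/-- The sequence `l` is empty or a temporal walk that starts at `s`. -/
def IsPath (G : TemporalGraph (Fin n)) (s : Fin n) (l : List (TimeArc (Fin n))) : Prop :=
  (∀ e ∈ l, e ∈ G.arcs) ∧ l.IsChain (fun e f => e.dst = f.src ∧ e.time ≤ f.time) ∧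
    ∀ e ∈ l.head?, e.src = s

/-- The last vertex appearance of a walk from `s`, where the empty walk ends in `(s, 0)`. -/
def endNode (G : TemporalGraph (Fin n)) (s : Fin n) (l : List (TimeArc (Fin n))) : ℕ :=
  (l.getLast?.map G.head).getD (G.node s 0)

variable {G : TemporalGraph (Fin n)} {s : Fin n} {l l' r : List (TimeArc (Fin n))}

theorem node_inj {v w t u : ℕ} (ht : t ≤ G.lifetime) (hu : u ≤ G.lifetime) :
    G.node v t = G.node w u ↔ v = w ∧ t = u := by
  refine ⟨fun h => ?_, by rintro ⟨rfl, rfl⟩; rfl⟩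
  unfold node at h
  have key : ∀ v t, t ≤ G.lifetime → (v * (G.lifetime + 1) + t) / (G.lifetime + 1) = v := by
    intro v t ht
    rw [Nat.mul_comm, Nat.mul_add_div (by omega), Nat.div_eq_of_lt (by omega), Nat.add_zero]
  have hvw : v = w := by rw [← key v t ht, h, key w u hu]
  subst hvw
  exact ⟨rfl, by omega⟩

theorem node_lt {v t : ℕ} (hv : v < n) (ht : t ≤ G.lifetime) :
    G.node v t < n * (G.lifetime + 1) := by
  unfold node
  calc v * (G.lifetime + 1) + t < (v + 1) * (G.lifetime + 1) := by rw [Nat.succ_mul]; omega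
    _ ≤ _ := Nat.mul_le_mul_right _ hv

/-- Time labels are positive, so no transition leads to the start `(s, 0)`. -/
theorem head_ne_root {e : TimeArc (Fin n)} (he : e ∈ G.arcs) : G.head e ≠ G.node s 0 := by
  intro h
  have h1 := G.time_pos e he
  have := ((node_inj (G.time_le e he) (Nat.zero_le _)).1 h).2
  omega

theorem head_lt {e : TimeArc (Fin n)} (he : e ∈ G.arcs) : G.head e < n * (G.lifetime + 1) :=
  node_lt e.dst.2 (G.time_le e he)

theorem tail_inj {e : TimeArc (Fin n)} {t u : ℕ} (ht : (e, t) ∈ G.steps) (hu : (e, u) ∈ G.steps)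
    (h : G.tail (e, t) = G.tail (e, u)) : t = u :=
  ((node_inj (ht.2.trans (G.time_le _ ht.1)) (hu.2.trans (G.time_le _ hu.1))).1 h).2

theorem endNode_nil : G.endNode s [] = G.node s 0 := rfl

theorem endNode_snoc {e : TimeArc (Fin n)} : G.endNode s (l ++ [e]) = G.head e := by
  simp [endNode]

theorem isPath_nil : G.IsPath s [] := by simp [IsPath]

theorem IsPath.of_append (h : G.IsPath s (l ++ r)) : G.IsPath s l := by
  refine ⟨fun e he => h.1 e (by simp [he]), (List.isChain_append.1 h.2.1).1, fun e he => ?_⟩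
  refine h.2.2 e ?_
  cases l with
  | nil => simp at he
  | cons a l => simpa using he

/-- One-step extension of walks. It suffices to know the last vertex appearance of the walk. -/
theorem isPath_snoc {e : TimeArc (Fin n)} :
    G.IsPath s (l ++ [e]) ↔ G.IsPath s l ∧
      ∃ t, (e, t) ∈ G.steps ∧ G.endNode s l = G.tail (e, t) := by
  rcases List.eq_nil_or_concat' l with rfl | ⟨l, f, rfl⟩
  · simp only [IsPath, steps, tail, endNode]
    constructor
    · intro h
      have h1 : e.src = s := by simpa using h.2.2
      exact ⟨by simp, 0, ⟨by simpa using h.1, Nat.zero_le _⟩, by simp [h1]⟩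
    · rintro ⟨-, t, ⟨he, ht⟩, h⟩
      have := (node_inj (Nat.zero_le _) (ht.trans (G.time_le _ he))).1 h
      exact ⟨by simpa using he, by simp, by simpa using Fin.ext this.1.symm⟩
  · constructor
    · intro h
      refine ⟨h.of_append, ?_⟩
      have he : e ∈ G.arcs := h.1 e (by simp)
      have hc := (List.isChain_append.1 h.2.1).2.2 f (by simp) e (by simp)
      exact ⟨f.time, ⟨he, hc.2⟩, by rw [endNode_snoc, head, tail, hc.1]⟩
    · rintro ⟨h, t, ⟨he, ht⟩, h'⟩
      have hf : f ∈ G.arcs := h.1 f (by simp)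
      rw [endNode_snoc] at h'
      have := (node_inj (G.time_le _ hf) (ht.trans (G.time_le _ he))).1 h'
      refine ⟨?_, ?_, ?_⟩
      · intro a ha
        rcases List.mem_append.1 ha with ha | ha
        · exact h.1 a ha
        · simp at ha; exact ha ▸ he
      · refine List.isChain_append.2 ⟨h.2.1, by simp, ?_⟩
        simp only [List.head?_cons]
        intro x hx y hy
        simp at hx hy
        subst hx hy
        exact ⟨Fin.ext this.1, this.2 ▸ ht⟩
      · intro a ha
        refine h.2.2 a ?_
        cases l <;> simpa using ha

theorem IsPath.endNode_lt (h : G.IsPath s l) : G.endNode s l < n * (G.lifetime + 1) := by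
  rcases List.eq_nil_or_concat' l with rfl | ⟨l, f, rfl⟩
  · exact node_lt s.2 (Nat.zero_le _)
  · rw [endNode_snoc]; exact head_lt (h.1 f (by simp))

theorem IsPath.eq_nil (h : G.IsPath s l) (h' : G.endNode s l = G.node s 0) : l = [] := by
  rcases List.eq_nil_or_concat' l with rfl | ⟨l, f, rfl⟩
  · rfl
  · rw [endNode_snoc] at h'; exact absurd h' (head_ne_root (h.1 f (by simp)))

theorem Walk.isPath (W : G.Walk) : G.IsPath W.source W.arcs := by
  refine ⟨W.mem_arcs, W.chain, fun e he => ?_⟩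
  rw [List.head?_eq_some_head W.ne_nil] at he
  simp at he
  rw [← he]; rfl

theorem IsPath.exists_walk (h : G.IsPath s l) (hl : l ≠ []) :
    ∃ W : G.Walk, W.arcs = l ∧ W.source = s :=
  ⟨⟨l, hl, h.1, h.2.1⟩, rfl, h.2.2 _ (List.head?_eq_some_head hl)⟩

theorem Walk.endNode_eq (W : G.Walk) : G.endNode s W.arcs = G.node W.target W.arrival := by
  rw [endNode, List.getLast?_eq_some_getLast W.ne_nil]; rfl

theorem Walk.arrival_le (W : G.Walk) : W.arrival ≤ G.lifetime :=
  G.time_le _ (W.mem_arcs _ (List.getLast_mem _))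

theorem Walk.arrival_pos (W : G.Walk) : 1 ≤ W.arrival :=
  G.time_pos _ (W.mem_arcs _ (List.getLast_mem _))

theorem Walk.isFromToAt_iff (W W' : G.Walk) :
    W'.IsFromToAt s W.target W.arrival ↔
      W'.source = s ∧ G.endNode s W'.arcs = G.endNode s W.arcs := by
  rw [Walk.endNode_eq, Walk.endNode_eq, node_inj W'.arrival_le W.arrival_le]
  simp only [Walk.IsFromToAt, Fin.ext_iff]

namespace CostFunction

variable {c : G.CostFunction}

open Classical in
/-- The cost function on sequences of transitions; sequences that are no walks get cost `∞`. -/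
noncomputable def listCost (c : G.CostFunction) (l : List (TimeArc (Fin n))) : WithTop ℝ :=
  if h : ∃ W : G.Walk, W.arcs = l then c h.choose else ⊤

theorem listCost_arcs (W : G.Walk) : c.listCost W.arcs = c W := by
  have h : ∃ W' : G.Walk, W'.arcs = W.arcs := ⟨W, rfl⟩
  rw [listCost, dif_pos h]
  exact congrArg c (Walk.ext h.choose_spec)

theorem oracle_listCost (h : G.IsPath s l) (hl : l ≠ []) : c.oracle l (c.listCost l) := by
  obtain ⟨W, rfl, -⟩ := h.exists_walk hl
  exact ⟨W, rfl, (listCost_arcs W).symm⟩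

/-- `l` is a walk of minimum cost from `s` to the vertex appearance `y`, or `l` is empty and `y` is
the start `(s, 0)`. -/
def IsMin (c : G.CostFunction) (s : Fin n) (y : ℕ) (l : List (TimeArc (Fin n))) : Prop :=
  G.IsPath s l ∧ G.endNode s l = y ∧
    ∀ l', G.IsPath s l' → G.endNode s l' = y → c.listCost l ≤ c.listCost l'

/-- The transition sequences of the optimal walks that start at `s`. -/
def optimalLists (c : G.CostFunction) (s : Fin n) : Set (List (TimeArc (Fin n))) :=
  {l | ∃ W ∈ c.optimalWalks, W.source = s ∧ W.arcs = l}

theorem optAt_le (hm : c.HasMinima) {v : Fin n} {t : ℕ} {W : G.Walk}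
    (h : W.IsFromToAt s v t) : c.optAt s v t ≤ c W := by
  have h' := hm s v t ⟨W, h⟩
  rw [optAt, dif_pos h']
  exact h'.choose_spec.2 W h

theorem IsMinAt.eq_optAt {v : Fin n} {t : ℕ} {W : G.Walk} (h : c.IsMinAt s v t W) :
    c W = c.optAt s v t := by
  have h' : ∃ W, c.IsMinAt s v t W := ⟨W, h⟩
  rw [optAt, dif_pos h']
  exact le_antisymm (h.2 _ h'.choose_spec.1) (h'.choose_spec.2 _ h.1)

theorem isMin_arcs_iff (W : G.Walk) :
    c.IsMin W.source (G.endNode W.source W.arcs) W.arcs ↔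
      c.IsMinAt W.source W.target W.arrival W := by
  constructor
  · rintro ⟨-, -, h⟩
    refine ⟨⟨rfl, rfl, rfl⟩, fun W' hW' => ?_⟩
    have h1 := (W.isFromToAt_iff W').1 hW'
    have := h W'.arcs (h1.1 ▸ W'.isPath) h1.2
    rwa [listCost_arcs, listCost_arcs] at this
  · rintro ⟨-, h⟩
    refine ⟨W.isPath, rfl, fun l' hl' he => ?_⟩
    have hne : l' ≠ [] := by
      rintro rfl
      exact W.ne_nil (W.isPath.eq_nil he.symm)
    obtain ⟨W', rfl, hs⟩ := hl'.exists_walk hne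
    rw [listCost_arcs, listCost_arcs]
    exact h W' ((W.isFromToAt_iff W').2 ⟨hs, he⟩)

theorem isMin_nil : c.IsMin s (G.node s 0) [] := by
  refine ⟨isPath_nil, rfl, fun l' h h' => ?_⟩
  rw [h.eq_nil h']

theorem isPath_of_optimal (h : l ∈ c.optimalLists s) : G.IsPath s l := by
  obtain ⟨W, -, rfl, rfl⟩ := h
  exact W.isPath

theorem ne_nil_of_optimal (h : l ∈ c.optimalLists s) : l ≠ [] := by
  obtain ⟨W, -, rfl, rfl⟩ := h
  exact W.ne_nil

theorem optimalLists_finite (hf : c.IsFinite) : (c.optimalLists s).Finite := by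
  refine (Set.Finite.image Walk.arcs hf).subset ?_
  rintro l ⟨W, hW, -, rfl⟩
  exact ⟨W, hW, rfl⟩

end CostFunction

theorem exists_first {α : Type} (P : α → Prop) (l : List α) (h : ∃ a ∈ l, P a) :
    ∃ l₁ a l₂, l = l₁ ++ a :: l₂ ∧ P a ∧ ∀ b ∈ l₁, ¬ P b := by
  induction l with
  | nil => simp at h
  | cons x l ih =>
    by_cases hx : P x
    · exact ⟨[], x, l, rfl, hx, by simp⟩
    · obtain ⟨l₁, a, l₂, rfl, ha, hl⟩ := ih (by simpa [hx] using h)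
      exact ⟨x :: l₁, a, l₂, rfl, ha, by simpa [hx] using hl⟩

theorem exists_last {α : Type} (P : α → Prop) (l : List α) (h : ∃ a ∈ l, P a) :
    ∃ l₁ a l₂, l = l₁ ++ a :: l₂ ∧ P a ∧ ∀ b ∈ l₂, ¬ P b := by
  obtain ⟨l₁, a, l₂, h1, h2, h3⟩ := exists_first P l.reverse (by simpa using h)
  refine ⟨l₂.reverse, a, l₁.reverse, ?_, h2, by simpa using h3⟩
  rw [← List.reverse_reverse l, h1]
  simp

namespace CostFunction

variable {c : G.CostFunction}

/-- Repetitions can be pumped: if an optimal walk visits a vertex appearance twice, then putting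
its prefix up to the last visit in place of the prefix up to the first visit gives a longer
optimal walk with the same property. -/
theorem exists_longer_of_repetition (hp : c.PrefixCompatible) {W : G.Walk}
    (hW : W ∈ c.optimalWalks) {e f : TimeArc (Fin n)} {l₁ l₂ l₃ : List (TimeArc (Fin n))}
    (hl : W.arcs = l₁ ++ e :: (l₂ ++ f :: l₃)) (hv : e.dst = f.dst) (ht : e.time = f.time) :
    ∃ W' ∈ c.optimalWalks, W.arcs.length < W'.arcs.length ∧
      ∃ (e f : TimeArc (Fin n)) (l₁ l₂ l₃ : List (TimeArc (Fin n))),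
        W'.arcs = l₁ ++ e :: (l₂ ++ f :: l₃) ∧ e.dst = f.dst ∧ e.time = f.time := by
  set P : TimeArc (Fin n) → Prop := fun a => a.dst = f.dst ∧ a.time = f.time with hP
  have hmem : ∃ a ∈ W.arcs, P a := ⟨f, by simp [hl], rfl, rfl⟩
  obtain ⟨a₁, g, a₂, h1, hg, hfirst⟩ := exists_first P _ hmem
  obtain ⟨b₁, k, b₂, h2, hk, hlast⟩ := exists_last P _ hmem
  -- the first visit is not after `e`, and the last visit is not before `f`
  have hlen1 : a₁.length ≤ l₁.length := by
    by_contra hlt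
    push Not at hlt
    have : e ∈ a₁ := by
      have hx : W.arcs[l₁.length]? = some e := by simp [hl]
      rw [h1, List.getElem?_append_left hlt] at hx
      exact List.mem_of_getElem? hx
    exact hfirst e this ⟨hv, ht⟩
  have hlen2 : l₁.length + 1 + l₂.length ≤ b₁.length := by
    by_contra hlt
    push Not at hlt
    have : f ∈ b₂ := by
      have hx : W.arcs[l₁.length + 1 + l₂.length]? = some f := by
        have : W.arcs = (l₁ ++ e :: l₂) ++ f :: l₃ := by simp [hl]
        rw [this, List.getElem?_append_right (by simp; omega)]
        simp [show l₁.length + 1 + l₂.length - (l₁.length + (l₂.length + 1)) = 0 by omega]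
      have : W.arcs = (b₁ ++ [k]) ++ b₂ := by simp [h2]
      rw [this, List.getElem?_append_right (by simp; omega)] at hx
      exact List.mem_of_getElem? hx
    exact hlast f this ⟨rfl, rfl⟩
  -- the part between the first and the last visit
  obtain ⟨m, hm⟩ : ∃ m, b₁ = (a₁ ++ [g]) ++ m := by
    have h3 : (a₁ ++ [g]) ++ a₂ = b₁ ++ (k :: b₂) := by rw [← h2, h1]; simp
    have hpre : a₁ ++ [g] <+: b₁ :=
      List.prefix_of_prefix_length_le ⟨a₂, h3⟩ ⟨k :: b₂, rfl⟩ (by simp; omega)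
    obtain ⟨m, hm⟩ := hpre
    exact ⟨m, hm.symm⟩
  have ha₂ : a₂ = m ++ k :: b₂ := by
    have h3 : (a₁ ++ [g]) ++ a₂ = (a₁ ++ [g]) ++ (m ++ k :: b₂) := by
      rw [← List.append_assoc _ m, ← hm, ← h2, h1]; simp
    exact List.append_cancel_left h3
  have hpath := W.isPath
  have hP1 : G.IsPath W.source (a₁ ++ [g]) := by
    refine IsPath.of_append (r := a₂) ?_
    simpa [h1] using hpath
  have hP2 : G.IsPath W.source (b₁ ++ [k]) := by
    refine IsPath.of_append (r := b₂) ?_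
    simpa [h2] using hpath
  obtain ⟨P₁, hP₁, hs₁⟩ := hP1.exists_walk (by simp)
  obtain ⟨P₂, hP₂, hs₂⟩ := hP2.exists_walk (by simp)
  have ht1 : P₁.target = f.dst ∧ P₁.arrival = f.time := by
    simp only [Walk.target, Walk.arrival, hP₁]; simpa using hg
  have ht2 : P₂.target = f.dst ∧ P₂.arrival = f.time := by
    simp only [Walk.target, Walk.arrival, hP₂]; simpa using hk
  have hopt := hp.1 W hW f.dst f.time P₂ b₂ (by simp [hP₂, h2]) ht2.1 ht2.2
    (by rintro ⟨a, ha, ha'⟩; exact hlast a ha ha')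
  obtain ⟨X, hX, hXa⟩ := hp.2 W hW f.dst f.time P₁ a₂ (by simp [hP₁, h1]) ht1.1 ht1.2
    (by rintro ⟨a, ha, ha'⟩; exact hfirst a (by simpa [hP₁] using ha) ha') P₂
    ⟨hs₂, ht2.1, ht2.2⟩ hopt
  refine ⟨X, hX, ?_, g, k, a₁, m, a₂, ?_, by rw [hg.1, hk.1], by rw [hg.2, hk.2]⟩
  · rw [hXa, h1, hP₂, hm]; simp
  · rw [hXa, hP₂, hm]; simp

/-- Optimal walks do not repeat vertex appearances: otherwise there would be arbitrarily long
optimal walks, but there are only finitely many. -/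
theorem no_repetition (hf : c.IsFinite) (hp : c.PrefixCompatible) {W : G.Walk}
    (hW : W ∈ c.optimalWalks) {e f : TimeArc (Fin n)} {l₁ l₂ l₃ : List (TimeArc (Fin n))}
    (hl : W.arcs = l₁ ++ e :: (l₂ ++ f :: l₃)) : ¬ (e.dst = f.dst ∧ e.time = f.time) := by
  intro h
  set R : Set G.Walk := {W ∈ c.optimalWalks | ∃ (e f : TimeArc (Fin n))
    (l₁ l₂ l₃ : List (TimeArc (Fin n))),
    W.arcs = l₁ ++ e :: (l₂ ++ f :: l₃) ∧ e.dst = f.dst ∧ e.time = f.time} with hR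
  have hfin : R.Finite := hf.subset fun W hW => hW.1
  obtain ⟨X, hX, hmax⟩ := Set.exists_max_image R (fun W => W.arcs.length) hfin
    ⟨W, hW, e, f, l₁, l₂, l₃, hl, h⟩
  obtain ⟨hXo, e', f', m₁, m₂, m₃, hm, hv, ht⟩ := hX
  obtain ⟨Y, hY, hlt, hrep⟩ := exists_longer_of_repetition hp hXo hm hv ht
  exact absurd (hmax Y ⟨hY, hrep⟩) (by simpa using hlt)

/-- Distinct prefixes of an optimal walk end in distinct vertex appearances. -/
theorem endNode_prefix_ne (hf : c.IsFinite) (hp : c.PrefixCompatible)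
    {m : List (TimeArc (Fin n))} (h : l ++ m ++ r ∈ c.optimalLists s) (hm : m ≠ []) :
    G.endNode s l ≠ G.endNode s (l ++ m) := by
  intro he
  have hpath := isPath_of_optimal h
  obtain ⟨W, hW, rfl, hWa⟩ := h
  obtain ⟨m, f, rfl⟩ : ∃ m' f, m = m' ++ [f] := by
    rcases List.eq_nil_or_concat' m with rfl | h
    · exact absurd rfl hm
    · exact h
  rw [← List.append_assoc, endNode_snoc] at he
  have hfa : f ∈ G.arcs := hpath.1 f (by simp)
  rcases List.eq_nil_or_concat' l with rfl | ⟨l, e, rfl⟩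
  · exact head_ne_root hfa he.symm
  · have hea : e ∈ G.arcs := hpath.1 e (by simp)
    rw [endNode_snoc, head, head, node_inj (G.time_le _ hea) (G.time_le _ hfa)] at he
    exact no_repetition hf hp hW (l₁ := l) (e := e) (l₂ := m) (f := f) (l₃ := r)
      (by simp [hWa]) ⟨Fin.ext he.1, he.2⟩

/-- Every prefix of an optimal walk has minimum cost. -/
theorem isMin_prefix (hm : c.HasMinima) (hf : c.IsFinite) (hp : c.PrefixCompatible)
    (h : l ++ r ∈ c.optimalLists s) : c.IsMin s (G.endNode s l) l := by
  by_cases hl : l = []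
  · subst hl; exact isMin_nil
  have hpath := isPath_of_optimal h
  have hne := fun (m r' : List (TimeArc (Fin n))) (e : TimeArc (Fin n)) (hr : r = m ++ e :: r') =>
    endNode_prefix_ne hf hp (s := s) (l := l) (m := m ++ [e]) (r := r')
      (by simpa [hr] using h) (by simp)
  obtain ⟨W, hW, hs, hWa⟩ := h
  obtain ⟨P, rfl, rfl⟩ := hpath.of_append.exists_walk hl
  rw [isMin_arcs_iff]
  -- without repetitions, the end of `P` is the last visit
  have hc := hp.1 W hW _ _ P r hWa rfl rfl (by
    rintro ⟨e, he, h1, h2⟩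
    obtain ⟨m, r', hr⟩ := List.append_of_mem he
    refine hne m r' e hr ?_
    rw [← List.append_assoc, endNode_snoc, Walk.endNode_eq, head, h1, h2])
  rw [hs] at hc
  exact ⟨⟨rfl, rfl, rfl⟩, fun W' hW' => hc ▸ optAt_le hm hW'⟩

/-- Every prefix of an optimal walk may be exchanged for any other walk of minimum cost to the
same vertex appearance. -/
theorem optimal_exchange (hf : c.IsFinite) (hp : c.PrefixCompatible)
    (h : l ++ r ∈ c.optimalLists s) (h' : c.IsMin s (G.endNode s l) l') :
    l' ++ r ∈ c.optimalLists s := by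
  by_cases hl : l = []
  · subst hl
    rwa [h'.1.eq_nil h'.2.1]
  have hpath := isPath_of_optimal h
  have hl' : l' ≠ [] := by
    rintro rfl
    exact hl (hpath.of_append.eq_nil h'.2.1.symm)
  have hne := fun (m r' : List (TimeArc (Fin n))) (e : TimeArc (Fin n))
      (hm : l = m ++ [e] ++ r') (hr : r' ≠ []) =>
    endNode_prefix_ne hf hp (s := s) (l := m ++ [e]) (m := r') (r := r)
      (by simpa [hm] using h) hr
  obtain ⟨W, hW, hs, hWa⟩ := h
  obtain ⟨P, rfl, rfl⟩ := hpath.of_append.exists_walk hl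
  obtain ⟨Q, rfl, hQ⟩ := h'.1.exists_walk hl'
  have hmin : c.IsMinAt P.source P.target P.arrival Q := by
    refine ⟨(P.isFromToAt_iff Q).2 ⟨hQ, h'.2.1⟩, fun W' hW' => ?_⟩
    have h1 := (P.isFromToAt_iff W').1 hW'
    have := h'.2.2 W'.arcs (h1.1 ▸ W'.isPath) h1.2
    rwa [listCost_arcs, listCost_arcs] at this
  -- without repetitions, the end of `P` is the first visit
  obtain ⟨X, hX, hXa⟩ := hp.2 W hW _ _ P r hWa rfl rfl (by
    rintro ⟨e, he, h1, h2⟩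
    obtain ⟨m, r', hr⟩ := List.append_of_mem he
    refine hne m (r' ++ [P.arcs.getLast P.ne_nil]) e ?_ (by simp) ?_
    · conv_lhs => rw [← List.dropLast_append_getLast P.ne_nil, hr]
      simp
    · have : m ++ [e] ++ (r' ++ [P.arcs.getLast P.ne_nil]) = P.arcs := by
        conv_rhs => rw [← List.dropLast_append_getLast P.ne_nil, hr]
        simp
      rw [this, endNode_snoc, Walk.endNode_eq, head, h1, h2]) Q
    (hs ▸ hmin.1) (hs ▸ hmin.eq_optAt)
  refine ⟨X, hX, ?_, hXa⟩
  simp only [Walk.source, hXa]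
  rw [List.head_append_of_ne_nil Q.ne_nil]
  exact hQ

end CostFunction

end TemporalGraph

/-! ### Good vertex appearances -/

namespace TemporalGraph

namespace CostFunction

variable {n : ℕ} {G : TemporalGraph (Fin n)} {s : Fin n} {l l' r : List (TimeArc (Fin n))}
variable {c : G.CostFunction} {y : ℕ}

/-- The vertex appearance `y` lies on an optimal walk from `s`; the start `(s, 0)` counts as lying
on all of them. -/
def Good (c : G.CostFunction) (s : Fin n) (y : ℕ) : Prop :=
  ∃ l r, l ++ r ∈ c.optimalLists s ∧ G.endNode s l = y

/-- Finiteness, prefix-compatibility and attainment of the minima. -/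
structure Admissible (c : G.CostFunction) : Prop where
  hasMinima : c.HasMinima
  isFinite : c.IsFinite
  prefixCompatible : c.PrefixCompatible

theorem Good.exists_isMin (hc : c.Admissible) (h : c.Good s y) :
    ∃ l, c.IsMin s y l := by
  obtain ⟨l, r, h, rfl⟩ := h
  exact ⟨l, isMin_prefix hc.1 hc.2 hc.3 h⟩

theorem Good.exists_suffix (hc : c.Admissible) (h : c.Good s y) :
    ∃ r, ∀ l, c.IsMin s y l → l ++ r ∈ c.optimalLists s := by
  obtain ⟨l, r, h, rfl⟩ := h
  exact ⟨r, fun l' h' => optimal_exchange hc.2 hc.3 h h'⟩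

theorem Good.finite (hc : c.Admissible) (h : c.Good s y) : {l | c.IsMin s y l}.Finite := by
  obtain ⟨r, hr⟩ := h.exists_suffix hc
  refine Set.Finite.of_finite_image (f := fun l => l ++ r)
    ((optimalLists_finite (s := s) hc.2).subset ?_) (fun _ _ _ _ h => List.append_cancel_right h)
  rintro _ ⟨l, hl, rfl⟩
  exact hr l hl

/-- The walks of minimum cost to good vertex appearances are closed under removing the last
transition. -/
theorem Good.init {e : TimeArc (Fin n)} (hc : c.Admissible) (h : c.Good s y)
    (hl : c.IsMin s y (l ++ [e])) :
    c.Good s (G.endNode s l) ∧ c.IsMin s (G.endNode s l) l := by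
  obtain ⟨r, hr⟩ := h.exists_suffix hc
  have h' := hr _ hl
  rw [List.append_assoc] at h'
  exact ⟨⟨l, _, h', rfl⟩, isMin_prefix hc.1 hc.2 hc.3 h'⟩

/-- Whether a transition can be the last one of a walk of minimum cost does not depend on the walk
of minimum cost that is extended. -/
theorem Good.snoc {e : TimeArc (Fin n)} (hc : c.Admissible) (h : c.Good s y)
    (hl : c.IsMin s y (l ++ [e])) (hl' : c.IsMin s (G.endNode s l) l') :
    c.IsMin s y (l' ++ [e]) := by
  obtain ⟨r, hr⟩ := h.exists_suffix hc
  have h' := hr _ hl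
  rw [List.append_assoc] at h'
  have h2 := optimal_exchange hc.2 hc.3 h' hl'
  rw [← List.append_assoc] at h2
  have h3 := isMin_prefix hc.1 hc.2 hc.3 h2
  rw [endNode_snoc] at h3
  have h4 := hl.2.1
  rw [endNode_snoc] at h4
  rwa [h4] at h3

/-- Walks of minimum cost to good vertex appearances are short, as they never repeat a vertex
appearance. -/
theorem Good.length_lt (hc : c.Admissible) (h : c.Good s y) (hl : c.IsMin s y l) :
    l.length < n * (G.lifetime + 1) := by
  obtain ⟨r, hr⟩ := h.exists_suffix hc
  have ho := hr l hl
  have hinj : Set.InjOn (fun k => G.endNode s (l.take k))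
      (Finset.range (l.length + 1) : Set ℕ) := by
    have key : ∀ i j, i < j → j ≤ l.length →
        G.endNode s (l.take i) ≠ G.endNode s (l.take j) := by
      intro i j hij hj
      have h1 : l.take j = l.take i ++ (l.take j).drop i := by
        conv_lhs => rw [← List.take_append_drop i (l.take j)]
        rw [List.take_take, Nat.min_eq_left hij.le]
      rw [h1]
      refine endNode_prefix_ne hc.2 hc.3 (r := l.drop j ++ r) ?_ ?_
      · rw [← h1, ← List.append_assoc, List.take_append_drop]
        exact ho
      · intro h0
        have := congrArg List.length h0
        simp at this
        omega
    intro i hi j hj hij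
    simp only [Finset.coe_range, Set.mem_Iio] at hi hj
    rcases lt_trichotomy i j with h | h | h
    · exact absurd hij (key i j h (by omega))
    · exact h
    · exact absurd hij.symm (key j i h (by omega))
  have := Finset.card_le_card_of_injOn (t := Finset.range (n * (G.lifetime + 1))) _
    (fun k _ => by
      have hp : G.IsPath s (l.take k) := by
        refine IsPath.of_append (r := l.drop k) ?_
        rw [List.take_append_drop]; exact hl.1
      simpa using hp.endNode_lt) hinj
  simpa using this

/-! ### Relaxation -/

/-- What is stored for each vertex appearance `y` reached from `s`: a walk to `y`, its cost and its
length plus one. Entry `0` of `len` means that no walk to `y` has been found. -/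
structure Table (n : ℕ) where
  len : ℕ → ℕ
  cost : ℕ → WithTop ℝ
  walk : ℕ → List (TimeArc (Fin n))

variable {B : Table n} {p : TimeArc (Fin n) × ℕ}

/-- The entries of the table describe walks from `s`. The cost entry of the start `(s, 0)`, whose
walk is empty, has no meaning. -/
structure Table.Valid (c : G.CostFunction) (s : Fin n) (B : Table n) : Prop where
  len_root : B.len (G.node s 0) = 1
  isPath : ∀ y, 0 < B.len y → G.IsPath s (B.walk y)
  endNode_eq : ∀ y, 0 < B.len y → G.endNode s (B.walk y) = y
  len_eq : ∀ y, 0 < B.len y → B.len y = (B.walk y).length + 1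
  cost_eq : ∀ y, 0 < B.len y → y ≠ G.node s 0 → B.cost y = c.listCost (B.walk y)
  cost_top : ∀ y < n * (G.lifetime + 1), B.len y = 0 → B.cost y = ⊤

/-- The stored walk at the tail of the pair `p`, extended by the transition of `p`. -/
def Table.candidate (G : TemporalGraph (Fin n)) (B : Table n) (p : TimeArc (Fin n) × ℕ) :
    List (TimeArc (Fin n)) := B.walk (G.tail p) ++ [p.1]

/-- The candidate walk of `p` is better than the walk stored at the head of `p`: it is cheaper,
or equally cheap and longer. -/
def Table.Improves (c : G.CostFunction) (B : Table n) (p : TimeArc (Fin n) × ℕ) : Prop :=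
  c.listCost (B.candidate G p) ≤ B.cost (G.head p.1) ∧
    (c.listCost (B.candidate G p) < B.cost (G.head p.1) ∨
      B.len (G.head p.1) < B.len (G.tail p) + 1)

/-- The table with the candidate walk of `p` stored at the head of `p`. -/
noncomputable def Table.update (c : G.CostFunction) (B : Table n) (p : TimeArc (Fin n) × ℕ) :
    Table n where
  len := Function.update B.len (G.head p.1) (B.len (G.tail p) + 1)
  cost := Function.update B.cost (G.head p.1) (c.listCost (B.candidate G p))
  walk := Function.update B.walk (G.head p.1) (B.candidate G p)

open Classical in
/-- One relaxation step. -/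
noncomputable def Table.relax (c : G.CostFunction) (B : Table n) (p : TimeArc (Fin n) × ℕ) :
    Table n :=
  if 0 < B.len (G.tail p) ∧ B.Improves c p then B.update c p else B

theorem Table.Valid.walk_root (h : B.Valid c s) : B.walk (G.node s 0) = [] := by
  have h1 : 0 < B.len (G.node s 0) := by rw [h.len_root]; exact one_pos
  exact (h.isPath _ h1).eq_nil (h.endNode_eq _ h1)

theorem Table.Valid.candidate_isPath (h : B.Valid c s) (hp : p ∈ G.steps)
    (h0 : 0 < B.len (G.tail p)) : G.IsPath s (B.candidate G p) :=
  isPath_snoc.2 ⟨h.isPath _ h0, p.2, hp, h.endNode_eq _ h0⟩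

theorem Table.candidate_endNode : G.endNode s (B.candidate G p) = G.head p.1 := endNode_snoc

theorem Table.Valid.update (h : B.Valid c s) (hp : p ∈ G.steps) (h0 : 0 < B.len (G.tail p)) :
    (B.update c p).Valid c s := by
  have hr : G.head p.1 ≠ G.node s 0 := head_ne_root hp.1
  have hne : ∀ y, y ≠ G.head p.1 → (B.update c p).len y = B.len y ∧
      (B.update c p).cost y = B.cost y ∧ (B.update c p).walk y = B.walk y := by
    intro y hy
    simp [Table.update, hy]
  have heq : (B.update c p).len (G.head p.1) = B.len (G.tail p) + 1 ∧
      (B.update c p).cost (G.head p.1) = c.listCost (B.candidate G p) ∧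
      (B.update c p).walk (G.head p.1) = B.candidate G p := by
    simp [Table.update]
  refine ⟨?_, ?_, ?_, ?_, ?_, ?_⟩
  · rw [(hne _ hr.symm).1, h.len_root]
  all_goals
    intro y
    by_cases hy : y = G.head p.1
    · subst hy
      simp only [heq]
      first
        | exact fun _ => h.candidate_isPath hp h0
        | exact fun _ => candidate_endNode
        | exact fun _ => by simp [candidate, h.len_eq _ h0]
    · simp only [hne y hy]
      first
        | exact h.isPath y
        | exact h.endNode_eq y
        | exact h.len_eq y
        | exact h.cost_eq y
        | exact h.cost_top y

theorem Table.Valid.relax (h : B.Valid c s) (hp : p ∈ G.steps) : (B.relax c p).Valid c s := by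
  unfold Table.relax
  split_ifs with h0
  · exact h.update hp h0.1
  · exact h

/-- The table holds a walk of minimum cost to `y` that has at least `m` transitions. -/
structure Table.Covers (c : G.CostFunction) (s : Fin n) (B : Table n) (y m : ℕ) : Prop where
  isMin : c.IsMin s y (B.walk y)
  lt_len : m < B.len y

/-- A covered vertex appearance stays covered: its stored walk is replaced only by a longer one of
minimum cost. -/
theorem Table.Covers.relax {m : ℕ} (h : B.Covers c s y m) (hB : B.Valid c s) (hp : p ∈ G.steps) :
    (B.relax c p).Covers c s y m := by
  unfold Table.relax
  split_ifs with h0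
  · by_cases hy : y = G.head p.1
    · subst hy
      have hpos : 0 < B.len (G.head p.1) := (Nat.zero_le _).trans_lt h.lt_len
      have hcost := hB.cost_eq _ hpos (head_ne_root hp.1)
      have hpath := hB.candidate_isPath hp h0.1
      have hmin := h.isMin.2.2 _ hpath candidate_endNode
      obtain ⟨-, hle, hlt⟩ := h0
      rw [hcost] at hle hlt
      refine ⟨⟨?_, ?_, ?_⟩, ?_⟩
      · simpa [Table.update] using hpath
      · simpa [Table.update] using candidate_endNode
      · simpa [Table.update] using fun l' h1 h2 => hle.trans (h.isMin.2.2 l' h1 h2)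
      · have := hlt.resolve_left hmin.not_gt
        have := h.lt_len
        simp [Table.update]; omega
    · exact ⟨by simpa [Table.update, hy] using h.isMin, by simpa [Table.update, hy] using h.lt_len⟩
  · exact h

/-- Relaxing the last step of a walk of minimum cost covers its end, provided that its
second to last vertex appearance is covered. -/
theorem Table.Covers.relax_new (hc : c.Admissible) (hB : B.Valid c s) (hp : p ∈ G.steps)
    (hy : c.Good s y) (hl : c.IsMin s y (l ++ [p.1])) (he : G.endNode s l = G.tail p)
    (h : B.Covers c s (G.tail p) l.length) :
    (B.relax c p).Covers c s y (l.length + 1) := by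
  obtain rfl : G.head p.1 = y := by rw [← hl.2.1, endNode_snoc]
  have h0 : 0 < B.len (G.tail p) := (Nat.zero_le _).trans_lt h.lt_len
  have hcand : c.IsMin s (G.head p.1) (B.candidate G p) := hy.snoc hc hl (he ▸ h.isMin)
  have hlen := h.lt_len
  have hle : c.listCost (B.candidate G p) ≤ B.cost (G.head p.1) := by
    rcases Nat.eq_zero_or_pos (B.len (G.head p.1)) with h1 | h1
    · rw [hB.cost_top _ (head_lt hp.1) h1]; exact le_top
    · rw [hB.cost_eq _ h1 (head_ne_root hp.1)]
      exact hcand.2.2 _ (hB.isPath _ h1) (hB.endNode_eq _ h1)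
  unfold Table.relax
  split_ifs with h1
  · exact ⟨by simpa [Table.update] using hcand, by simp [Table.update]; omega⟩
  · simp only [Improves, not_and, not_or, not_lt] at h1
    obtain ⟨h2, h3⟩ := h1 h0 hle
    have hpos : 0 < B.len (G.head p.1) := by omega
    rw [hB.cost_eq _ hpos (head_ne_root hp.1)] at h2
    exact ⟨⟨hB.isPath _ hpos, hB.endNode_eq _ hpos,
      fun l' h4 h5 => h2.trans (hcand.2.2 l' h4 h5)⟩, by omega⟩

/-- The invariant of the relaxation rounds, in round `k` after relaxing the pairs in `S`: all walks
of minimum cost to good vertex appearances are covered that have at most `k` transitions, or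
`k + 1` transitions with the last step in `S`. -/
structure Table.Round (c : G.CostFunction) (s : Fin n) (k : ℕ) (S : Set (TimeArc (Fin n) × ℕ))
    (B : Table n) : Prop where
  valid : B.Valid c s
  covers_le : ∀ y, c.Good s y → ∀ l, c.IsMin s y l → l.length ≤ k → B.Covers c s y l.length
  covers_mem : ∀ y, c.Good s y → ∀ l p, c.IsMin s y (l ++ [p.1]) → G.endNode s l = G.tail p →
    p ∈ S → l.length ≤ k → B.Covers c s y (l.length + 1)

theorem Table.Round.zero (hB : B.Valid c s) : B.Round c s 0 ∅ := by
  refine ⟨hB, fun y _ l hl h => ?_, by simp⟩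
  obtain rfl : l = [] := List.eq_nil_of_length_eq_zero (by omega)
  obtain rfl := hl.2.1
  rw [endNode_nil]
  refine ⟨?_, by rw [hB.len_root]; exact one_pos⟩
  rw [hB.walk_root]
  exact isMin_nil

theorem Table.Round.relax {k : ℕ} {S : Set (TimeArc (Fin n) × ℕ)} (hc : c.Admissible)
    (h : B.Round c s k S) (hp : p ∈ G.steps) : (B.relax c p).Round c s k (insert p S) := by
  refine ⟨h.valid.relax hp, fun y hy l hl hk => (h.covers_le y hy l hl hk).relax h.valid hp, ?_⟩
  intro y hy l q hl he hq hk
  rcases hq with rfl | hq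
  · refine Table.Covers.relax_new hc h.valid hp hy hl he ?_
    have := hy.init hc hl
    rw [he] at this
    exact h.covers_le _ this.1 l this.2 hk
  · exact (h.covers_mem y hy l q hl he hq hk).relax h.valid hp

theorem Table.Round.next {k : ℕ} (h : B.Round c s k G.steps) : B.Round c s (k + 1) ∅ := by
  refine ⟨h.valid, fun y hy l hl hk => ?_, by simp⟩
  rcases List.eq_nil_or_concat' l with rfl | ⟨l, e, rfl⟩
  · exact h.covers_le y hy _ hl (by simp)
  · obtain ⟨-, t, ht, he⟩ := isPath_snoc.1 hl.1
    simp only [List.length_append, List.length_singleton] at hk ⊢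
    exact h.covers_mem y hy l (e, t) hl he ht (by omega)

/-- The table holds the longest walk of minimum cost to every good vertex appearance. -/
structure Table.Complete (c : G.CostFunction) (s : Fin n) (B : Table n) : Prop where
  valid : B.Valid c s
  covers : ∀ y, c.Good s y → ∀ l, c.IsMin s y l → B.Covers c s y l.length

theorem Table.Round.complete (hc : c.Admissible) (h : B.Round c s (n * (G.lifetime + 1)) ∅) :
    B.Complete c s :=
  ⟨h.valid, fun y hy l hl => h.covers_le y hy l hl (hy.length_lt hc hl).le⟩

/-! ### Tight steps -/

/-- The steps whose candidate walk is as cheap as the walk stored at their head. -/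
def Table.tight (c : G.CostFunction) (B : Table n) : Set (TimeArc (Fin n) × ℕ) :=
  {p | p ∈ G.steps ∧ 0 < B.len (G.tail p) ∧
    c.listCost (B.candidate G p) = B.cost (G.head p.1)}

theorem Table.Complete.isMin (hc : c.Admissible) (hB : B.Complete c s) (hy : c.Good s y) :
    c.IsMin s y (B.walk y) ∧ 0 < B.len y := by
  obtain ⟨l, hl⟩ := hy.exists_isMin hc
  have := hB.covers y hy l hl
  exact ⟨this.1, (Nat.zero_le _).trans_lt this.2⟩

theorem Table.Complete.candidate_isMin (hc : c.Admissible) (hB : B.Complete c s)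
    (hp : p ∈ B.tight c) (hy : c.Good s (G.head p.1)) :
    c.IsMin s (G.head p.1) (B.candidate G p) := by
  obtain ⟨h1, h2⟩ := hB.isMin hc hy
  refine ⟨hB.valid.candidate_isPath hp.1 hp.2.1, candidate_endNode, fun l' h3 h4 => ?_⟩
  rw [hp.2.2, hB.valid.cost_eq _ h2 (head_ne_root hp.1.1)]
  exact h1.2.2 l' h3 h4

/-- No tight step leads from a vertex appearance that is not good to a good one. -/
theorem Table.Complete.good_tail (hc : c.Admissible) (hB : B.Complete c s)
    (hp : p ∈ B.tight c) (hy : c.Good s (G.head p.1)) : c.Good s (G.tail p) := by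
  have := (hy.init hc (hB.candidate_isMin hc hp hy)).1
  rwa [hB.valid.endNode_eq _ hp.2.1] at this

theorem Table.Complete.isMin_snoc (hc : c.Admissible) (hB : B.Complete c s)
    (hp : p ∈ B.tight c) (hy : c.Good s (G.head p.1)) (hl : c.IsMin s (G.tail p) l) :
    c.IsMin s (G.head p.1) (l ++ [p.1]) := by
  refine hy.snoc hc (hB.candidate_isMin hc hp hy) ?_
  rwa [hB.valid.endNode_eq _ hp.2.1]

/-- The stored walks to good vertex appearances are longest ones, so their lengths increase along
tight steps. -/
theorem Table.Complete.len_lt (hc : c.Admissible) (hB : B.Complete c s)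
    (hp : p ∈ B.tight c) (hy : c.Good s (G.head p.1)) : B.len (G.tail p) < B.len (G.head p.1) := by
  have h1 := (hB.covers _ hy _ (hB.candidate_isMin hc hp hy)).2
  rw [hB.valid.len_eq _ hp.2.1]
  simpa [candidate] using h1

theorem Table.Complete.len_tail_le (hc : c.Admissible) (hB : B.Complete c s)
    (hp : p ∈ B.tight c) (hy : c.Good s (G.head p.1)) :
    B.len (G.tail p) ≤ n * (G.lifetime + 1) := by
  have hg := hB.good_tail hc hp hy
  rw [hB.valid.len_eq _ hp.2.1]
  exact hg.length_lt hc (hB.isMin hc hg).1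

/-- Every walk of minimum cost to a good vertex appearance ends with a tight step. -/
theorem Table.Complete.exists_tight (hc : c.Admissible) (hB : B.Complete c s) (hy : c.Good s y)
    (hl : c.IsMin s y l) (h0 : y ≠ G.node s 0) :
    ∃ p ∈ B.tight c, G.head p.1 = y ∧ ∃ l', c.IsMin s (G.tail p) l' ∧ l = l' ++ [p.1] := by
  rcases List.eq_nil_or_concat' l with rfl | ⟨l, e, rfl⟩
  · exact absurd hl.2.1.symm h0
  · obtain ⟨-, t, ht, he⟩ := isPath_snoc.1 hl.1
    obtain rfl : G.head e = y := by rw [← hl.2.1, endNode_snoc]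
    obtain ⟨hg, hm⟩ := hy.init hc hl
    rw [he] at hg hm
    obtain ⟨h1, h2⟩ := hB.isMin hc hg
    obtain ⟨h3, h4⟩ := hB.isMin hc hy
    refine ⟨(e, t), ⟨ht, h2, ?_⟩, rfl, l, hm, rfl⟩
    have h5 := hy.snoc hc hl (l' := B.walk (G.tail (e, t))) (he ▸ h1)
    rw [hB.valid.cost_eq _ h4 (head_ne_root ht.1)]
    exact le_antisymm (h5.2.2 _ h3.1 h3.2.1) (h3.2.2 _ h5.1 h5.2.1)

/-- `L` enumerates tight steps by increasing length of the stored walks at their tails, among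
them all tight steps with a good head. -/
structure Table.Enumerates (c : G.CostFunction) (s : Fin n) (B : Table n)
    (L : List (TimeArc (Fin n) × ℕ)) : Prop where
  nodup : L.Nodup
  tight : ∀ p ∈ L, p ∈ B.tight c
  mem : ∀ p ∈ B.tight c, c.Good s (G.head p.1) → p ∈ L
  sorted : L.Pairwise (fun p q => B.len (G.tail p) ≤ B.len (G.tail q))

/-! ### Counting walks that avoid a vertex -/

/-- The walk never enters the vertex with number `v`; this holds vacuously for `v ≥ n`. -/
def Avoids (v : ℕ) (l : List (TimeArc (Fin n))) : Prop := ∀ e ∈ l, (e.dst : ℕ) ≠ v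

/-- The number of walks of minimum cost from `s` to `y` that never enter the vertex `v`. -/
noncomputable def avoidCount (c : G.CostFunction) (s : Fin n) (v y : ℕ) : ℕ :=
  {l | c.IsMin s y l ∧ Avoids v l}.ncard

variable {L : List (TimeArc (Fin n) × ℕ)}

open Classical in
/-- Splitting the walks of minimum cost to a set of good vertex appearances by their last step. -/
theorem ncard_avoids_eq_sum (hc : c.Admissible) (hB : B.Complete c s) (hL : B.Enumerates c s L)
    (v : ℕ) (Y : Set ℕ) (hY : ∀ y ∈ Y, c.Good s y) (h0 : G.node s 0 ∉ Y) :
    (({l | (∃ y ∈ Y, c.IsMin s y l) ∧ Avoids v l}.ncard : ℕ) : ℚ) =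
      (L.map (fun p => if G.head p.1 ∈ Y ∧ (p.1.dst : ℕ) ≠ v then
        (c.avoidCount s v (G.tail p) : ℚ) else 0)).sum := by
  set F := L.toFinset.filter (fun p => G.head p.1 ∈ Y ∧ (p.1.dst : ℕ) ≠ v) with hF
  have hmemF : ∀ p, p ∈ F ↔ p ∈ L ∧ G.head p.1 ∈ Y ∧ (p.1.dst : ℕ) ≠ v := by
    intro p; simp [hF]
  have hset : {l | (∃ y ∈ Y, c.IsMin s y l) ∧ Avoids v l} =
      ⋃ p ∈ (F : Set (TimeArc (Fin n) × ℕ)), (fun l => l ++ [p.1]) ''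
        {l | c.IsMin s (G.tail p) l ∧ Avoids v l} := by
    ext l
    simp only [Set.mem_ofPred_eq, Set.mem_iUnion, Set.mem_image, Finset.mem_coe, hmemF]
    constructor
    · rintro ⟨⟨y, hy, hl⟩, ha⟩
      obtain ⟨p, hp, rfl, l', hl', rfl⟩ := hB.exists_tight hc (hY y hy) hl (fun h => h0 (h ▸ hy))
      exact ⟨p, ⟨hL.mem p hp (hY _ hy), hy, ha p.1 (by simp)⟩, l',
        ⟨hl', fun e he => ha e (by simp [he])⟩, rfl⟩
    · rintro ⟨p, ⟨hp, hy, hv⟩, l', ⟨hl', ha⟩, rfl⟩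
      refine ⟨⟨_, hy, hB.isMin_snoc hc (hL.tight p hp) (hY _ hy) hl'⟩, fun e he => ?_⟩
      rcases List.mem_append.1 he with he | he
      · exact ha e he
      · simp at he; rwa [he]
  have hinj : ∀ e : TimeArc (Fin n), Function.Injective (fun l => l ++ [e]) :=
    fun e _ _ h => List.append_cancel_right h
  have hfin : ∀ p ∈ F, {l | c.IsMin s (G.tail p) l ∧ Avoids v l}.Finite := fun p hp =>
    have hp' := (hmemF p).1 hp
    ((hB.good_tail hc (hL.tight p hp'.1) (hY _ hp'.2.1)).finite hc).subset fun l hl => hl.1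
  rw [hset, Set.Finite.ncard_biUnion F.finite_toSet (fun p hp => (hfin p hp).image _),
    finsum_mem_coe_finset, Nat.cast_sum, ← List.sum_toFinset _ hL.nodup, ← Finset.sum_filter]
  · exact Finset.sum_congr rfl fun p _ => by rw [Set.ncard_image_of_injective _ (hinj _)]; rfl
  · intro p hp q hq hpq
    refine Set.disjoint_left.2 ?_
    rintro _ ⟨l, hl, rfl⟩ ⟨l', hl', h⟩
    have h1 := List.append_inj' h rfl
    have h2 : p.1 = q.1 := by simpa using h1.2.symm
    have hp' := (hL.tight p ((hmemF p).1 hp).1).1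
    have hq' := (hL.tight q ((hmemF q).1 hq).1).1
    obtain ⟨e, t⟩ := p
    obtain ⟨e', u⟩ := q
    obtain rfl : e = e' := h2
    refine hpq (congrArg _ (tail_inj hp' hq' ?_))
    rw [← hl.1.2.1, ← hl'.1.2.1, h1.1]

/-- Adding the count at the tail of `p` to the count at its head, unless `p` enters `v`. -/
noncomputable def push (G : TemporalGraph (Fin n)) (v : ℕ) (N : ℕ → ℚ)
    (p : TimeArc (Fin n) × ℕ) : ℕ → ℚ :=
  if (p.1.dst : ℕ) = v then N
  else Function.update N (G.head p.1) (N (G.head p.1) + N (G.tail p))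

theorem avoidCount_root (v : ℕ) : c.avoidCount s v (G.node s 0) = 1 := by
  rw [avoidCount, Set.ncard_eq_one]
  refine ⟨[], Set.ext fun l => ⟨fun h => h.1.1.eq_nil h.1.2.1, ?_⟩⟩
  rintro rfl
  exact ⟨isMin_nil, by simp [Avoids]⟩

theorem avoidCount_eq_sum (hc : c.Admissible) (hB : B.Complete c s) (hL : B.Enumerates c s L)
    (v : ℕ) (hy : c.Good s y) :
    (c.avoidCount s v y : ℚ) = (if y = G.node s 0 then 1 else 0) +
      (L.map (fun p => if G.head p.1 = y ∧ (p.1.dst : ℕ) ≠ v then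
        (c.avoidCount s v (G.tail p) : ℚ) else 0)).sum := by
  by_cases h0 : y = G.node s 0
  · subst h0
    rw [avoidCount_root, if_pos rfl, List.sum_eq_zero]
    · simp
    · intro x hx
      obtain ⟨p, hp, rfl⟩ := List.mem_map.1 hx
      rw [if_neg fun h => head_ne_root (hL.tight p hp).1.1 h.1]
  · have := ncard_avoids_eq_sum hc hB hL v {y} (by simpa using hy) (by simpa using Ne.symm h0)
    simp only [Set.mem_singleton_iff, exists_eq_left] at this
    rw [if_neg h0, zero_add, avoidCount, this]

/-- Pushing counts along the enumeration computes `avoidCount` at all good vertex appearances: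
when a step is pushed, all steps into its tail have been pushed before. -/
theorem foldl_push (hc : c.Admissible) (hB : B.Complete c s) (hL : B.Enumerates c s L)
    (v : ℕ) {N : ℕ → ℚ} (hN : N (G.node s 0) = 1) (hN' : ∀ p ∈ L, N (G.head p.1) = 0)
    (hy : c.Good s y) : L.foldl (push G v) N y = c.avoidCount s v y := by
  suffices key : ∀ L₁ L₂, L = L₁ ++ L₂ → ∀ y, c.Good s y →
      L₁.foldl (push G v) N y = (if y = G.node s 0 then 1 else 0) +
        (L₁.map (fun p => if G.head p.1 = y ∧ (p.1.dst : ℕ) ≠ v then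
          (c.avoidCount s v (G.tail p) : ℚ) else 0)).sum by
    rw [key L [] (by simp) y hy, ← avoidCount_eq_sum hc hB hL v hy]
  intro L₁
  induction L₁ using List.reverseRecOn with
  | nil =>
    intro L₂ _ y hy
    by_cases h0 : y = G.node s 0
    · simp [h0, hN]
    · obtain ⟨l, hl⟩ := hy.exists_isMin hc
      obtain ⟨p, hp, rfl, -⟩ := hB.exists_tight hc hy hl h0
      simp [h0, hN' p (hL.mem p hp hy)]
  | append_singleton L₁ p ih =>
    intro L₂ hLe y hy
    have ih' := ih (p :: L₂) (by simp [hLe])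
    rw [List.foldl_append, List.foldl_cons, List.foldl_nil, List.map_append, List.sum_append,
      ← add_assoc, ← ih' y hy]
    simp only [List.map_cons, List.map_nil, List.sum_singleton, push]
    by_cases hv : (p.1.dst : ℕ) = v
    · simp [hv]
    by_cases hy' : G.head p.1 = y
    · subst hy'
      have hpt := hL.tight p (by simp [hLe])
      have hgt := hB.good_tail hc hpt hy
      have htail : L₁.foldl (push G v) N (G.tail p) = c.avoidCount s v (G.tail p) := by
        rw [ih' _ hgt, avoidCount_eq_sum hc hB hL v hgt, hLe]
        simp only [List.map_append, List.sum_append]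
        have hz : ∀ q ∈ p :: L₂, G.head q.1 ≠ G.tail p := by
          -- a later step into the tail of `p` would contradict the order of the list
          intro q hq he
          have hqt := hL.tight q (by rw [hLe]; simpa using Or.inr hq)
          have hlt := hB.len_lt hc hqt (he ▸ hgt)
          rw [he] at hlt
          have hs := hL.sorted
          rw [hLe, List.append_assoc] at hs
          rcases List.mem_cons.1 hq with rfl | hq
          · omega
          · have := (List.pairwise_cons.1 (List.pairwise_append.1 hs).2.1).1 q hq
            omega
        have hz1 : ((p :: L₂).map (fun q => if G.head q.1 = G.tail p ∧ (q.1.dst : ℕ) ≠ v then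
          (c.avoidCount s v (G.tail q) : ℚ) else 0)).sum = 0 := by
          refine List.sum_eq_zero fun x hx => ?_
          obtain ⟨q, hq, rfl⟩ := List.mem_map.1 hx
          rw [if_neg fun h => hz q hq h.1]
        rw [List.map_cons, List.sum_cons] at hz1
        simp only [List.map_cons, List.map_nil, List.sum_singleton]
        linarith
      simp [hv, htail]
    · simp [hv, hy', Function.update_of_ne (Ne.symm hy')]

/-! ### The ends of optimal walks -/

/-- The vertex appearances in which optimal walks from `s` end. -/
def ends (c : G.CostFunction) (s : Fin n) : Set ℕ :=
  {y | ∃ l ∈ c.optimalLists s, G.endNode s l = y}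

theorem good_of_mem_ends (h : y ∈ c.ends s) : c.Good s y := by
  obtain ⟨l, hl, rfl⟩ := h
  exact ⟨l, [], by simpa using hl, rfl⟩

theorem mem_optimal_of_ends (hc : c.Admissible) (h : y ∈ c.ends s) (hl : c.IsMin s y l) :
    l ∈ c.optimalLists s := by
  obtain ⟨l', hl', rfl⟩ := h
  simpa using optimal_exchange hc.2 hc.3 (r := []) (by simpa using hl') hl

theorem isMin_of_optimal (hc : c.Admissible) (h : l ∈ c.optimalLists s) :
    c.IsMin s (G.endNode s l) l :=
  isMin_prefix hc.1 hc.2 hc.3 (r := []) (by simpa using h)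

theorem optTo_le {z : Fin n} {t : ℕ} (h1 : 1 ≤ t) (h2 : t ≤ G.lifetime) :
    c.optTo s z ≤ c.optAt s z t :=
  Finset.inf_le (f := fun t => c.optAt s z t) (Finset.mem_Icc.2 ⟨h1, h2⟩)

theorem optTo_le_walk (hc : c.Admissible) (W : G.Walk) : c.optTo W.source W.target ≤ c W :=
  (optTo_le W.arrival_pos W.arrival_le).trans (optAt_le hc.1 ⟨rfl, rfl, rfl⟩)

theorem exists_optimal {z : Fin n} (h : c.optTo s z < ⊤) :
    ∃ W ∈ c.optimalWalks, W.source = s ∧ W.target = z ∧ c W = c.optTo s z := by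
  have hne : (Finset.Icc 1 G.lifetime).Nonempty := by
    by_contra hne
    rw [Finset.not_nonempty_iff_eq_empty] at hne
    simp [optTo, hne] at h
  obtain ⟨t, -, ht⟩ := Finset.exists_mem_eq_inf _ hne (fun t => c.optAt s z t)
  change c.optTo s z = c.optAt s z t at ht
  have hW : ∃ W, c.IsMinAt s z t W := by
    by_contra hW
    rw [ht, optAt, dif_neg hW] at h
    exact lt_irrefl _ h
  obtain ⟨W, hW⟩ := hW
  have hcW := hW.eq_optAt
  obtain ⟨⟨rfl, rfl, -⟩, -⟩ := hW
  exact ⟨W, ⟨by rw [hcW, ← ht]; exact h, by rw [hcW, ht]⟩, rfl, rfl, by rw [hcW, ht]⟩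

theorem Table.Complete.cost_of_optimal (hc : c.Admissible) (hB : B.Complete c s) {W : G.Walk}
    (hW : W ∈ c.optimalWalks) (hs : W.source = s) :
    B.cost (G.node W.target W.arrival) = c W := by
  subst hs
  have ho : W.arcs ∈ c.optimalLists W.source := ⟨W, hW, rfl, rfl⟩
  have hm := isMin_of_optimal hc ho
  have hg : c.Good W.source (G.endNode W.source W.arcs) := good_of_mem_ends ⟨_, ho, rfl⟩
  obtain ⟨h1, h2⟩ := hB.isMin hc hg
  rw [← W.endNode_eq (s := W.source), hB.valid.cost_eq _ h2
    (fun h => W.ne_nil (W.isPath.eq_nil h)), ← listCost_arcs (c := c) W]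
  exact le_antisymm (h1.2.2 _ hm.1 hm.2.1) (hm.2.2 _ h1.1 h1.2.1)

theorem Table.Valid.exists_walk (hB : B.Valid c s) {e : TimeArc (Fin n)} (he : e ∈ G.arcs)
    (h : B.cost (G.head e) < ⊤) :
    ∃ W : G.Walk, W.source = s ∧ W.target = e.dst ∧ G.endNode s W.arcs = G.head e ∧
      c W = B.cost (G.head e) := by
  have hpos : 0 < B.len (G.head e) := by
    by_contra h0
    rw [hB.cost_top _ (head_lt he) (by omega)] at h
    exact lt_irrefl _ h
  have hend := hB.endNode_eq _ hpos
  have hne : B.walk (G.head e) ≠ [] := by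
    intro h0
    rw [h0] at hend
    exact head_ne_root he hend.symm
  obtain ⟨W, hW, hs⟩ := (hB.isPath _ hpos).exists_walk hne
  have h1 : G.endNode s W.arcs = G.head e := by rw [hW, hend]
  refine ⟨W, hs, ?_, h1, ?_⟩
  · rw [W.endNode_eq, head, node_inj W.arrival_le (G.time_le _ he)] at h1
    exact Fin.ext h1.1
  · rw [hB.cost_eq _ hpos (head_ne_root he), ← hW, listCost_arcs]

/-- `m` holds, for every vertex `z`, the minimum of the costs that `B` stores for the appearances
of `z`. -/
structure Table.IsMinCost (G : TemporalGraph (Fin n)) (B : Table n) (m : ℕ → WithTop ℝ) : Prop where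
  le : ∀ e ∈ G.arcs, m e.dst ≤ B.cost (G.head e)
  attained : ∀ z : Fin n, m z = ⊤ ∨ ∃ e ∈ G.arcs, e.dst = z ∧ m z = B.cost (G.head e)

/-- Although entries for vertex appearances that are not good may be too large, the minima over
all appearances of a vertex are right, as they are attained at good ones. -/
theorem Table.Complete.minCost_eq (hc : c.Admissible) (hB : B.Complete c s) {m : ℕ → WithTop ℝ}
    (hm : B.IsMinCost G m) (z : Fin n) : m z = c.optTo s z := by
  apply le_antisymm
  · by_cases h : c.optTo s z < ⊤
    · obtain ⟨W, hW, hs, rfl, hcW⟩ := exists_optimal h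
      rw [← hcW, ← hB.cost_of_optimal hc hW hs]
      exact hm.le _ (W.mem_arcs _ (List.getLast_mem W.ne_nil))
    · rw [not_lt_top_iff.1 h]; exact le_top
  · rcases hm.attained z with h | ⟨e, he, hz, h⟩
    · rw [h]; exact le_top
    · rw [h]
      by_cases ht : B.cost (G.head e) < ⊤
      · obtain ⟨W, rfl, hW, -, hcW⟩ := hB.valid.exists_walk he ht
        rw [← hcW, ← show W.target = z from hW.trans hz]
        exact optTo_le_walk hc W
      · rw [not_lt_top_iff.1 ht]; exact le_top

/-- How the ends of optimal walks are recognized. -/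
theorem Table.Complete.mem_ends_iff (hc : c.Admissible) (hB : B.Complete c s)
    {m : ℕ → WithTop ℝ} (hm : B.IsMinCost G m) {e : TimeArc (Fin n)} (he : e ∈ G.arcs) :
    (¬ m e.dst < B.cost (G.head e) ∧ B.cost (G.head e) < ⊤) ↔ G.head e ∈ c.ends s := by
  rw [hB.minCost_eq hc hm, not_lt]
  constructor
  · rintro ⟨h1, h2⟩
    obtain ⟨W, rfl, hW, hend, hcW⟩ := hB.valid.exists_walk he h2
    rw [← hcW, ← hW] at h1
    exact ⟨W.arcs, ⟨W, ⟨hcW ▸ h2, le_antisymm h1 (optTo_le_walk hc W)⟩, rfl, rfl⟩, hend⟩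
  · rintro ⟨l, ⟨W, hW, rfl, rfl⟩, hend⟩
    have h1 := hB.cost_of_optimal hc hW rfl
    rw [W.endNode_eq] at hend
    rw [hend] at h1
    rw [head, node_inj W.arrival_le (G.time_le _ he)] at hend
    rw [h1, ← show W.target = e.dst from Fin.ext hend.1]
    exact ⟨hW.2.le, hW.1⟩

/-- The ends of optimal walks from `s` to `z`. -/
def endsAt (c : G.CostFunction) (s z : Fin n) : Set ℕ :=
  {y | y ∈ c.ends s ∧ ∃ t ≤ G.lifetime, y = G.node z t}

theorem head_mem_endsAt {e : TimeArc (Fin n)} (he : e ∈ G.arcs) {z : Fin n} :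
    G.head e ∈ c.endsAt s z ↔ G.head e ∈ c.ends s ∧ e.dst = z := by
  refine and_congr_right fun _ => ⟨?_, ?_⟩
  · rintro ⟨t, ht, h⟩
    exact Fin.ext ((node_inj (G.time_le _ he) ht).1 h).1
  · rintro rfl
    exact ⟨_, G.time_le _ he, rfl⟩

theorem root_notMem_endsAt {z : Fin n} : G.node s 0 ∉ c.endsAt s z := by
  rintro ⟨⟨l, hl, h⟩, -⟩
  exact ne_nil_of_optimal hl ((isPath_of_optimal hl).eq_nil h)

theorem isMin_endsAt_iff (hc : c.Admissible) {z : Fin n} :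
    (∃ y ∈ c.endsAt s z, c.IsMin s y l) ↔
      ∃ W ∈ c.optimalWalks, W.IsFromTo s z ∧ W.arcs = l := by
  constructor
  · rintro ⟨y, ⟨hy, t, ht, rfl⟩, hl⟩
    obtain ⟨W, hW, rfl, rfl⟩ := mem_optimal_of_ends hc hy hl
    have := hl.2.1
    rw [W.endNode_eq, node_inj W.arrival_le ht] at this
    exact ⟨W, hW, ⟨rfl, Fin.ext this.1⟩, rfl⟩
  · rintro ⟨W, hW, ⟨rfl, rfl⟩, rfl⟩
    have ho : W.arcs ∈ c.optimalLists W.source := ⟨W, hW, rfl, rfl⟩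
    exact ⟨_, ⟨⟨_, ho, rfl⟩, _, W.arrival_le, W.endNode_eq⟩, isMin_of_optimal hc ho⟩

theorem arcs_injective : Function.Injective (Walk.arcs (G := G)) := fun _ _ h => Walk.ext h

/-- With `v ≥ n` there is no vertex to be avoided. -/
theorem walkCount_eq (hc : c.Admissible) {z : Fin n} {v : ℕ} (hv : n ≤ v) :
    walkCount c.optimalWalks s z =
      {l | (∃ y ∈ c.endsAt s z, c.IsMin s y l) ∧ Avoids v l}.ncard := by
  rw [walkCount, ← Set.ncard_image_of_injective _ arcs_injective]
  congr 1
  ext l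
  simp only [Set.mem_image, Set.mem_ofPred_eq, isMin_endsAt_iff hc, and_assoc]
  constructor
  · rintro ⟨W, h1, h2, rfl⟩
    exact ⟨⟨W, h1, h2, rfl⟩, fun e _ => by have := e.dst.2; omega⟩
  · rintro ⟨⟨W, h1, h2, rfl⟩, -⟩
    exact ⟨W, h1, h2, rfl⟩

theorem walkCount_sub_through (hc : c.Admissible) {z v : Fin n} (hs : s ≠ v) :
    walkCount c.optimalWalks s z = walkCountThrough c.optimalWalks s z v +
      {l | (∃ y ∈ c.endsAt s z, c.IsMin s y l) ∧ Avoids v l}.ncard := by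
  have h1 : {l | (∃ y ∈ c.endsAt s z, c.IsMin s y l) ∧ Avoids v l} =
      Walk.arcs '' {W | W ∈ c.optimalWalks ∧ W.IsFromTo s z ∧ ¬ W.GoesThrough v} := by
    ext l
    simp only [Set.mem_image, Set.mem_ofPred_eq, isMin_endsAt_iff hc, and_assoc]
    constructor
    · rintro ⟨⟨W, h1, h2, rfl⟩, h3⟩
      refine ⟨W, h1, h2, ?_, rfl⟩
      rintro (h | ⟨e, he, h⟩)
      · exact hs (h2.1.symm.trans h)
      · exact h3 e he (by rw [h])
    · rintro ⟨W, h1, h2, h3, rfl⟩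
      exact ⟨⟨W, h1, h2, rfl⟩, fun e he h => h3 (Or.inr ⟨e, he, Fin.ext h⟩)⟩
  rw [h1, Set.ncard_image_of_injective _ arcs_injective, walkCount, walkCountThrough,
    ← Set.ncard_union_eq (Set.disjoint_left.2 fun W h h' => h'.2.2 h.2.2)
      (hc.2.subset fun W h => h.1) (hc.2.subset fun W h => h.1)]
  congr 1
  ext W
  simp only [Set.mem_ofPred_eq, Set.mem_union]
  tauto

open Classical in
/-- Both counts of `s`-`z`-walks as sums over the enumerated steps. -/
theorem sum_ends_eq (hc : c.Admissible) (hB : B.Complete c s) (hL : B.Enumerates c s L) (v : ℕ)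
    (z : Fin n) (hz : (z : ℕ) ≠ v) {N : ℕ → ℚ}
    (hN : ∀ y, c.Good s y → N y = c.avoidCount s v y) :
    (L.map (fun p => if G.head p.1 ∈ c.ends s ∧ p.1.dst = z then N (G.tail p) else 0)).sum =
      ({l | (∃ y ∈ c.endsAt s z, c.IsMin s y l) ∧ Avoids v l}.ncard : ℚ) := by
  rw [ncard_avoids_eq_sum hc hB hL v _ (fun y hy => good_of_mem_ends hy.1) root_notMem_endsAt]
  congr 1
  refine List.map_congr_left fun p hp => ?_
  have ht := hL.tight p hp
  rw [head_mem_endsAt ht.1.1]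
  by_cases h : G.head p.1 ∈ c.ends s ∧ p.1.dst = z
  · have h' : (p.1.dst : ℕ) ≠ v := by rwa [h.2]
    rw [if_pos h, if_pos ⟨h, h'⟩, hN _ (hB.good_tail hc ht (good_of_mem_ends h.1))]
  · rw [if_neg h, if_neg fun h' => h h'.1]

open Classical in
/-- The contribution of the source `s` to the betweenness of `v`. -/
theorem sum_pairDependency (hc : c.Admissible) (hB : B.Complete c s) (hL : B.Enumerates c s L)
    {v : Fin n} (hs : s ≠ v) {N N' S : ℕ → ℚ}
    (hN : ∀ y, c.Good s y → N y = c.avoidCount s n y)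
    (hN' : ∀ y, c.Good s y → N' y = c.avoidCount s v y)
    (hS : ∀ z : Fin n, S z = (L.map (fun p =>
      if G.head p.1 ∈ c.ends s ∧ p.1.dst = z then N (G.tail p) else 0)).sum) :
    (L.map (fun p => if G.head p.1 ∈ c.ends s ∧ p.1.dst ≠ v then
      (N (G.tail p) - N' (G.tail p)) / S p.1.dst else 0)).sum =
    ∑ z, if v ≠ z then pairDependency c.optimalWalks s z v else 0 := by
  have hz : ∀ z, v ≠ z → pairDependency c.optimalWalks s z v = (L.map (fun p =>
      if G.head p.1 ∈ c.ends s ∧ p.1.dst = z then (N (G.tail p) - N' (G.tail p)) / S z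
      else 0)).sum := by
    intro z hvz
    have h1 := hS z
    rw [sum_ends_eq hc hB hL n z z.2.ne hN, ← walkCount_eq hc le_rfl] at h1
    have h2 := sum_ends_eq hc hB hL v z (fun h => hvz (Fin.ext h.symm)) hN'
    have h3 := sum_ends_eq hc hB hL n z z.2.ne hN
    rw [← walkCount_eq hc le_rfl] at h3
    have h4 := walkCount_sub_through hc (z := z) hs
    have h5 : (L.map (fun p => if G.head p.1 ∈ c.ends s ∧ p.1.dst = z then
        (N (G.tail p) - N' (G.tail p)) / S z else 0)).sum =
        ((L.map (fun p => if G.head p.1 ∈ c.ends s ∧ p.1.dst = z then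
          N (G.tail p) else 0)).sum -
        (L.map (fun p => if G.head p.1 ∈ c.ends s ∧ p.1.dst = z then
          N' (G.tail p) else 0)).sum) / S z := by
      clear hL hS h1 h2 h3
      induction L with
      | nil => simp
      | cons p L ih =>
        simp only [List.map_cons, List.sum_cons, ih]
        split_ifs <;> ring
    have h6 : (walkCount c.optimalWalks s z : ℚ) = walkCountThrough c.optimalWalks s z v +
      ({l | (∃ y ∈ c.endsAt s z, c.IsMin s y l) ∧ Avoids v l}.ncard : ℚ) := by
      exact_mod_cast h4
    rw [h5, h2, h3, h1, h6, add_sub_cancel_right, ← h6, pairDependency]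
    -- if there are no optimal walks, the quotient is `0 / 0 = 0`
    split_ifs with h0
    · simp [h0]
    · rfl
  rw [Finset.sum_congr rfl fun z _ => if_ctx_congr Iff.rfl (hz z) fun _ => rfl]
  clear hL hS hz
  induction L with
  | nil => simp
  | cons p L ih =>
    simp only [List.map_cons, List.sum_cons, ite_add_zero, Finset.sum_add_distrib]
    rw [ih]
    congr 1
    by_cases hp : G.head p.1 ∈ c.ends s
    · simp only [hp, true_and]
      rw [Finset.sum_eq_single p.1.dst]
      · simp [eq_comm]
      · intro z _ hz
        simp [Ne.symm hz]
      · simp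
    · simp [hp]

end CostFunction

end TemporalGraph

/-! ### The program -/

namespace RAM

/-- Equality of two indices. -/
def Test.eq (x y : IdxExpr) : Test := .and (.not (.lt x y)) (.not (.lt y x))

theorem Test.holds_eq {A : Type} {σ : State A} {x y : IdxExpr} :
    (Test.eq x y).Holds σ ↔ x.eval σ = y.eval σ := by
  simp only [Test.eq, Test.Holds]; omega

local infixr:60 " ;; " => RAM.Prog.seq

namespace Betweenness

/-! The arrays of the program.

Index arrays: `0` holds `n`, the number of transitions and the lifetime; `1`, `2`, `3` hold the
transitions; cell `v` of `4` holds `G.node v 0`; `5` holds the table entries `len`; `6`, `7`, `8`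
hold the tail, the head and the vertex of the head of the listed tight steps; `9` is the number of
listed steps; `10` is the source, `11` the round, `12` the number of a transition, `13` an arrival
time, `14` a vertex, `15` a position in the list of steps, `16` the tail and `17` the head of the
current step.

Number arrays: `0` is the result, `1` counts walks, `2` counts walks that avoid a vertex, `3` counts
optimal walks by their target.

Cost arrays: `0` holds the table entries `cost`, `1` the cost of the candidate walk, `2` the minimum
cost for each target; `3` is never written.

Walk arrays: `0` holds the table entries `walk`, `1` the candidate walk; `2` is never written. -/

/-- The number `n * (lifetime + 1)` of possible codes of vertex appearances. -/
def numNodes : IdxExpr := .get 4 (.get 0 (.lit 0))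

/-- For all transitions and all arrival times up to the time of the transition. -/
def forSteps (p : Prog) : Prog :=
  .for 12 (.get 0 (.lit 1)) (.for 13 (.add (.get 3 (.var 12)) (.lit 1)) p)

/-- Compute the tail and the head of the current step. -/
def setStep : Prog :=
  .setIdx 16 (.lit 0) (.add (.get 4 (.get 1 (.var 12))) (.var 13)) ;;
  .setIdx 17 (.lit 0) (.add (.get 4 (.get 2 (.var 12))) (.get 3 (.var 12)))

/-- Build the candidate walk of the current step and query its cost. -/
def queryCandidate : Prog :=
  .extendWalk 1 (.lit 0) 0 (.var 16) (.var 12) ;; .query 1 (.lit 0) 1 (.lit 0)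

/-- Relax the current step. -/
def relaxStep : Prog :=
  setStep ;;
  .ite (.lt (.lit 0) (.get 5 (.var 16)))
    (queryCandidate ;;
      .ite (.and (.not (.costLt 0 (.var 17) 1 (.lit 0)))
          (.not (.and (.not (.costLt 1 (.lit 0) 0 (.var 17)))
            (.not (.lt (.get 5 (.var 17)) (.add (.get 5 (.var 16)) (.lit 1)))))))
        (.setIdx 5 (.var 17) (.add (.get 5 (.var 16)) (.lit 1)) ;;
          .copyCost 0 (.var 17) 1 (.lit 0) ;; .copyWalk 0 (.var 17) 1 (.lit 0))
        .skip)
    .skip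

/-- Relax all steps as often as there are codes of vertex appearances. -/
def relaxAll : Prog := .for 11 numNodes (forSteps relaxStep)

/-- Compute the minimum cost for each target from the table. -/
def computeMinCosts : Prog :=
  .for 12 (.get 0 (.lit 1))
    (.setIdx 17 (.lit 0) (.add (.get 4 (.get 2 (.var 12))) (.get 3 (.var 12))) ;;
      .ite (.costLt 0 (.var 17) 2 (.get 2 (.var 12)))
        (.copyCost 2 (.get 2 (.var 12)) 0 (.var 17)) .skip)

/-- In round `r`, append the current step to the list if it is tight and the table entry `len` of
its tail is `r + 1`. -/
def listStep : Prog :=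
  setStep ;;
  .ite (.eq (.get 5 (.var 16)) (.add (.var 11) (.lit 1)))
    (queryCandidate ;;
      .ite (.and (.not (.costLt 0 (.var 17) 1 (.lit 0))) (.not (.costLt 1 (.lit 0) 0 (.var 17))))
        (.setIdx 6 (.var 9) (.var 16) ;; .setIdx 7 (.var 9) (.var 17) ;;
          .setIdx 8 (.var 9) (.get 2 (.var 12)) ;; .setIdx 9 (.lit 0) (.add (.var 9) (.lit 1)))
        .skip)
    .skip

/-- List the tight steps by increasing entry `len` of their tails. -/
def listTightSteps : Prog :=
  .setIdx 9 (.lit 0) (.lit 0) ;; .for 11 numNodes (forSteps listStep)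

/-- Count, in the number array `a`, the walks that avoid the vertex in the variable `14`, or all
walks if that variable is `n`. -/
def countWalks (a : ℕ) : Prog :=
  .for 15 (.var 9) (.setNum a (.get 7 (.var 15)) (.lit 0)) ;;
  .setNum a (.get 4 (.var 10)) (.lit 1) ;;
  .for 15 (.var 9)
    (.ite (.eq (.get 8 (.var 15)) (.var 14)) .skip
      (.setNum a (.get 7 (.var 15))
        (.add (.get a (.get 7 (.var 15))) (.get a (.get 6 (.var 15))))))

/-- Whether optimal walks end in the head of the current listed step. -/
def isEnd : Test :=
  .and (.not (.costLt 2 (.get 8 (.var 15)) 0 (.get 7 (.var 15))))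
    (.costLt 0 (.get 7 (.var 15)) 3 (.lit 0))

/-- Count the optimal walks by their target. -/
def countByTarget : Prog :=
  .for 15 (.var 9)
    (.ite isEnd
      (.setNum 3 (.get 8 (.var 15))
        (.add (.get 3 (.get 8 (.var 15))) (.get 1 (.get 6 (.var 15)))))
      .skip)

/-- Add the contribution of the current source to the result of the current vertex. -/
def addDependencies : Prog :=
  .for 15 (.var 9)
    (.ite (.and isEnd (.not (.eq (.get 8 (.var 15)) (.var 14))))
      (.setNum 0 (.var 14)
        (.add (.get 0 (.var 14))
          (.div (.sub (.get 1 (.get 6 (.var 15))) (.get 2 (.get 6 (.var 15))))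
            (.get 3 (.get 8 (.var 15))))))
      .skip)

/-- Add the contribution of the current source for all vertices other than the source. -/
def allVertices : Prog :=
  .for 14 (.get 0 (.lit 0))
    (.ite (.eq (.var 14) (.var 10)) .skip (countWalks 2 ;; addDependencies))

/-- Reset the table: only the empty walk at the source is known. -/
def resetTable : Prog :=
  .for 16 numNodes (.setIdx 5 (.var 16) (.lit 0) ;; .copyCost 0 (.var 16) 3 (.lit 0)) ;;
  .setIdx 5 (.get 4 (.var 10)) (.lit 1) ;;
  .copyWalk 0 (.get 4 (.var 10)) 2 (.lit 0)

/-- Reset the minimum costs and the counts of the targets. -/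
def resetTargets : Prog :=
  .for 16 (.get 0 (.lit 0)) (.copyCost 2 (.var 16) 3 (.lit 0) ;; .setNum 3 (.var 16) (.lit 0))

/-- Add the contributions of the current source. -/
def oneSource : Prog :=
  resetTable ;; resetTargets ;; relaxAll ;; computeMinCosts ;; listTightSteps ;;
  .setIdx 14 (.lit 0) (.get 0 (.lit 0)) ;; countWalks 1 ;; countByTarget ;; allVertices

/-- Compute the codes `G.node v 0` by repeated addition. -/
def computeBases : Prog :=
  .for 16 (.get 0 (.lit 0))
    (.setIdx 4 (.add (.var 16) (.lit 1))
      (.add (.get 4 (.var 16)) (.add (.get 0 (.lit 2)) (.lit 1))))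

/-- The program. Without transitions it stops at once, since then the time bound is constant. -/
def main : Prog :=
  .ite (.lt (.lit 0) (.get 0 (.lit 1)))
    (computeBases ;; .for 10 (.get 0 (.lit 0)) oneSource) .skip

end Betweenness

end RAM

namespace TemporalGraph

open RAM RAM.Betweenness

variable {n : ℕ}

/-- The memory holds the input, and the cells that are never written have their initial values. -/
structure HasInput (G : TemporalGraph (Fin n)) (input : List (TimeArc (Fin n)))
    (σ : State (TimeArc (Fin n))) : Prop where
  numVertices : σ.idx 0 0 = n
  numArcs : σ.idx 0 1 = input.length
  lifetime : σ.idx 0 2 = G.lifetime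
  src : ∀ i e, input[i]? = some e → σ.idx 1 i = e.src
  dst : ∀ i e, input[i]? = some e → σ.idx 2 i = e.dst
  time : ∀ i e, input[i]? = some e → σ.idx 3 i = e.time
  cost_top : ∀ i, σ.cost 3 i = ⊤
  walk_nil : ∀ i, σ.walk 2 i = []

/-- The memory is prepared by `computeBases`. -/
structure HasBases (G : TemporalGraph (Fin n)) (input : List (TimeArc (Fin n)))
    (σ : State (TimeArc (Fin n))) : Prop extends HasInput G input σ where
  base : ∀ v ≤ n, σ.idx 4 v = G.node v 0

variable {G : TemporalGraph (Fin n)} {input : List (TimeArc (Fin n))} {c : G.CostFunction}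
variable {s : Fin n} {σ τ : State (TimeArc (Fin n))} {p : Prog}

theorem HasInput.of_frame (h : G.HasInput input σ) (hF : Frame p σ τ)
    (hi : ∀ a < 4, p.writes .idx a = false) (hc : p.writes .cost 3 = false)
    (hw : p.writes .walk 2 = false) : G.HasInput input τ := by
  obtain ⟨h0, h1, h2, h3, h4, h5, h6, h7⟩ := h
  rw [← hF.idx 0 (hi 0 (by decide))] at h0 h1 h2
  rw [← hF.idx 1 (hi 1 (by decide))] at h3
  rw [← hF.idx 2 (hi 2 (by decide))] at h4
  rw [← hF.idx 3 (hi 3 (by decide))] at h5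
  rw [← hF.cost 3 hc] at h6
  rw [← hF.walk 2 hw] at h7
  exact ⟨h0, h1, h2, h3, h4, h5, h6, h7⟩

theorem HasBases.of_frame (h : G.HasBases input σ) (hF : Frame p σ τ)
    (hi : ∀ a < 5, p.writes .idx a = false) (hc : p.writes .cost 3 = false)
    (hw : p.writes .walk 2 = false) : G.HasBases input τ :=
  ⟨h.toHasInput.of_frame hF (fun a ha => hi a (by omega)) hc hw,
    by rw [hF.idx 4 (hi 4 (by decide))]; exact h.base⟩

theorem HasBases.numNodes_eval (h : G.HasBases input σ) :
    numNodes.eval σ = n * (G.lifetime + 1) := by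
  simp [numNodes, IdxExpr.eval, h.numVertices, h.base n le_rfl, node]

/-- The table stored in the memory. -/
def table (σ : State (TimeArc (Fin n))) : CostFunction.Table n := ⟨σ.idx 5, σ.cost 0, σ.walk 0⟩

theorem table_of_frame (hF : Frame p σ τ) (h5 : p.writes .idx 5 = false)
    (h0 : p.writes .cost 0 = false) (h0' : p.writes .walk 0 = false) : table τ = table σ := by
  simp only [table, hF.idx 5 h5, hF.cost 0 h0, hF.walk 0 h0']

/-- The rule for loops over all steps: the invariant depends on the set of the steps that have been
processed. -/
theorem halts_forSteps {oracle : List (TimeArc (Fin n)) → WithTop ℝ → Prop} {k : ℕ}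
    {Q : State (TimeArc (Fin n)) → Prop}
    (I : Set (TimeArc (Fin n) × ℕ) → State (TimeArc (Fin n)) → Prop)
    (hnodup : input.Nodup) (hmem : ∀ e, e ∈ input ↔ e ∈ G.arcs) (hσ : G.HasBases input σ)
    (hi : ∀ a < 5, p.writes .idx a = false) (hi' : p.writes .idx 12 = false)
    (hi'' : p.writes .idx 13 = false)
    (hI : ∀ S τ a x, a = 12 ∨ a = 13 → I S τ → I S (τ.setVar a x)) (h0 : I ∅ σ)
    (hs : ∀ S e i t τ, input[i]? = some e → (e, t) ∈ G.steps → (e, t) ∉ S →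
      τ.idx 12 0 = i → τ.idx 13 0 = t → Frame (forSteps p) σ τ → I S τ →
      Halts input oracle p k (I (insert (e, t) S)) τ)
    (hQ : ∀ τ, Frame (forSteps p) σ τ → I G.steps τ → Q τ) :
    Halts input oracle (forSteps p)
      (input.length * ((G.lifetime + 1) * (k + 2) + 4) + 2) Q σ := by
  have hidx : ∀ a < 5, (forSteps p).writes .idx a = false := by
    intro a ha
    have : a ≠ 12 ∧ a ≠ 13 := by omega
    simp [forSteps, Prog.for, Prog.writes, hi a ha, this]
  have hinput : ∀ τ, Frame (forSteps p) σ τ → τ.idx 0 1 = input.length ∧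
      ∀ i e, input[i]? = some e → τ.idx 3 i = e.time := by
    intro τ hF
    rw [hF.idx 0 (hidx 0 (by decide)), hF.idx 3 (hidx 3 (by decide))]
    exact ⟨hσ.numArcs, hσ.time⟩
  -- the steps that belong to the first `i` transitions
  set D : ℕ → Set (TimeArc (Fin n) × ℕ) := fun i => {q | q.1 ∈ input.take i ∧ q.2 ≤ q.1.time}
    with hD
  refine Halts.for (fun i τ => I (D i) τ) ?_ ?_ ?_ ?_ ?_
  · simp [Prog.for, Prog.writes, hi']
  · exact fun τ hF => (hinput τ hF).1
  · have : D 0 = ∅ := by ext; simp [hD]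
    rw [this]
    exact hI _ _ _ _ (Or.inl rfl) h0
  · intro i hilt τ hF hc hIi
    obtain ⟨e, he⟩ : ∃ e, input[i]? = some e := ⟨_, List.getElem?_eq_getElem hilt⟩
    have hea : e ∈ G.arcs := (hmem e).1 (List.mem_of_getElem? he)
    have htake : input.take (i + 1) = input.take i ++ [e] := by
      rw [List.take_add_one, he]; rfl
    have hnot : e ∉ input.take i := by
      have h1 : (input.take (i + 1)).Nodup := hnodup.sublist (List.take_sublist _ _)
      rw [htake, List.nodup_append] at h1
      exact fun h => h1.2.2 e h e (by simp) rfl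
    have hframe : ∀ τ', Frame (.for 13 (.add (.get 3 (.var 12)) (.lit 1)) p) τ τ' →
        Frame (forSteps p) σ τ' ∧ τ'.idx 12 0 = i := by
      intro τ' hF'
      refine ⟨hF.trans (hF'.of_writes_le fun b a h => Prog.writes_for b a _ _ _ h), ?_⟩
      rw [hF'.idx 12 (by simp [Prog.for, Prog.writes, hi']), hc]
    refine Halts.le (k := (e.time + 1) * (k + 2) + 2) ?_ ?_
    · have := Nat.mul_le_mul_right (k + 2) (Nat.succ_le_succ (G.time_le e hea))
      simp only [Nat.succ_eq_add_one] at this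
      omega
    refine Halts.for (fun t τ => I (D i ∪ {q | q.1 = e ∧ q.2 < t}) τ) hi'' ?_ ?_ ?_ ?_
    · intro τ' hF'
      obtain ⟨h1, h2⟩ := hframe τ' hF'
      simp [IdxExpr.eval, h2, (hinput τ' h1).2 i e he]
    · have : D i ∪ {q | q.1 = e ∧ q.2 < 0} = D i := by ext; simp
      rw [this]
      exact hI _ _ _ _ (Or.inr rfl) hIi
    · intro t ht τ' hF' hc' hI'
      obtain ⟨h1, h2⟩ := hframe τ' hF'
      refine (hs _ e i t τ' he ⟨hea, by simp; omega⟩ ?_ h2 hc' h1 hI').mono le_rfl ?_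
      · rintro (h | h)
        · exact hnot h.1
        · exact lt_irrefl _ h.2
      · intro τ'' _ h3
        refine hI _ _ _ _ (Or.inr rfl) ?_
        convert h3 using 1
        ext ⟨f, u⟩
        simp only [Set.mem_union, Set.mem_ofPred_eq, Set.mem_insert_iff, Prod.mk.injEq,
          Nat.lt_succ_iff_lt_or_eq]
        tauto
    · intro τ' _ h3
      refine hI _ _ _ _ (Or.inl rfl) ?_
      convert h3 using 1
      ext ⟨f, u⟩
      simp only [hD, Set.mem_union, Set.mem_ofPred_eq, htake, List.mem_append,
        List.mem_singleton, Nat.lt_succ_iff]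
      constructor
      · rintro ⟨h | rfl, h'⟩
        · exact Or.inl ⟨h, h'⟩
        · exact Or.inr ⟨rfl, h'⟩
      · rintro (⟨h, h'⟩ | ⟨rfl, h'⟩)
        · exact ⟨Or.inl h, h'⟩
        · exact ⟨Or.inr rfl, h'⟩
  · intro τ hF h
    refine hQ τ hF ?_
    convert h using 1
    ext ⟨f, u⟩
    simp [hD, steps, hmem]

theorem halts_setStep {oracle : List (TimeArc (Fin n)) → WithTop ℝ → Prop} {i t : ℕ}
    {e : TimeArc (Fin n)} (hσ : G.HasBases input σ) (he : input[i]? = some e)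
    (hi : σ.idx 12 0 = i) (ht : σ.idx 13 0 = t) :
    Halts input oracle setStep 2
      (fun τ => τ = (σ.setVar 16 (G.tail (e, t))).setVar 17 (G.head e)) σ := by
  have h1 : σ.idx 4 e.src + t = G.tail (e, t) := by
    rw [hσ.base _ e.src.2.le]; simp [tail, node]
  have h2 : σ.idx 4 e.dst + e.time = G.head e := by
    rw [hσ.base _ e.dst.2.le]; simp [head, node]
  refine Halts.seq (k := 1) (l := 1) (Halts.setIdx (Halts.setIdx ?_))
  simp [IdxExpr.eval, State.setVar, write_apply, hi, ht, hσ.src i e he, hσ.dst i e he,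
    hσ.time i e he, h1, h2]

theorem halts_queryCandidate {i : ℕ} {q : TimeArc (Fin n) × ℕ}
    (he : input[i]? = some q.1) (hi : σ.idx 12 0 = i) (h16 : σ.idx 16 0 = G.tail q)
    (hB : (table σ).Valid c s) (hq : q ∈ G.steps) (h0 : 0 < σ.idx 5 (G.tail q)) :
    Halts input c.oracle queryCandidate 2
      (fun τ => τ.idx = σ.idx ∧ τ.cost 0 = σ.cost 0 ∧ τ.walk 0 = σ.walk 0 ∧
        τ.cost 1 0 = c.listCost ((table σ).candidate G q) ∧
        τ.walk 1 0 = (table σ).candidate G q) σ := by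
  refine Halts.seq (k := 1) (l := 1) (Halts.extendWalk q.1 (by simpa [IdxExpr.eval, hi] using he)
    (Halts.query (c.listCost ((table σ).candidate G q)) ?_ ?_))
  · have := CostFunction.oracle_listCost (c := c) (hB.candidate_isPath hq h0)
      (by simp [CostFunction.Table.candidate])
    simpa [write_apply, IdxExpr.eval, h16, CostFunction.Table.candidate, table] using this
  · simp [write_apply, IdxExpr.eval, h16, CostFunction.Table.candidate, table]

theorem halts_relaxStep {i t : ℕ} {e : TimeArc (Fin n)} (hσ : G.HasBases input σ)
    (he : input[i]? = some e) (hi : σ.idx 12 0 = i) (ht : σ.idx 13 0 = t)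
    (hB : (table σ).Valid c s) (hq : (e, t) ∈ G.steps) :
    Halts input c.oracle relaxStep 10
      (fun τ => table τ = (table σ).relax c (e, t)) σ := by
  refine Halts.le (k := 2 + 8) (by decide) (Halts.seq ((halts_setStep hσ he hi ht).mono le_rfl ?_))
  rintro _ - rfl
  set σ' := (σ.setVar 16 (G.tail (e, t))).setVar 17 (G.head e) with hσ'
  have htab : table σ' = table σ := by simp [table, hσ', State.setVar, write_apply]
  have h16 : σ'.idx 16 0 = G.tail (e, t) := by simp [hσ', State.setVar, write_apply]
  have h17 : σ'.idx 17 0 = G.head e := by simp [hσ', State.setVar, write_apply]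
  have h12 : σ'.idx 12 0 = i := by simp [hσ', State.setVar, write_apply, hi]
  rw [← htab] at hB ⊢
  clear_value σ'
  refine Halts.le (k := max 7 1 + 1) (by decide) (Halts.ite (fun h0 => ?_) fun h0 => ?_)
  · replace h0 : 0 < σ'.idx 5 (G.tail (e, t)) := by
      simpa [Test.Holds, IdxExpr.eval, h16] using h0
    refine Halts.seq (k := 2) (l := 5)
      ((halts_queryCandidate (q := (e, t)) he h12 h16 hB hq h0).mono le_rfl ?_)
    rintro ρ - ⟨h1, h2, h3, h4, h5⟩
    have hiff : (Test.and (.not (.costLt 0 (.var 17) 1 (.lit 0)))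
          (.not (.and (.not (.costLt 1 (.lit 0) 0 (.var 17)))
            (.not (.lt (.get 5 (.var 17)) (.add (.get 5 (.var 16)) (.lit 1))))))).Holds ρ ↔
        (table σ').Improves c (e, t) := by
      simp only [Test.Holds, IdxExpr.eval, h1, h2, h4, h16, h17, CostFunction.Table.Improves,
        not_and_or, not_lt, not_le, table]
    refine Halts.le (k := max 3 1 + 1) (by decide) (Halts.ite (fun h => ?_) fun h => ?_)
    · refine Halts.seq (k := 1) (l := 2) (Halts.setIdx (Halts.seq (k := 1) (l := 1)
        (Halts.copyCost (Halts.copyWalk ?_))))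
      rw [hiff] at h
      rw [CostFunction.Table.relax, if_pos ⟨h0, h⟩]
      simp [table, CostFunction.Table.update, IdxExpr.eval, write_apply, h1, h2, h3, h4, h5, h16,
        h17]
    · rw [hiff] at h
      rw [CostFunction.Table.relax, if_neg fun h' => h h'.2]
      refine Halts.skip ?_
      simp [table, h1, h2, h3]
  · rw [CostFunction.Table.relax, if_neg]
    · exact Halts.skip rfl
    · rintro ⟨h, -⟩
      exact h0 (by simpa [Test.Holds, IdxExpr.eval, h16, table] using h)

theorem halts_relaxAll (hc : c.Admissible) (hnodup : input.Nodup)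
    (hmem : ∀ e, e ∈ input ↔ e ∈ G.arcs) (hσ : G.HasBases input σ) (hB : (table σ).Valid c s) :
    Halts input c.oracle relaxAll
      (n * (G.lifetime + 1) * (input.length * ((G.lifetime + 1) * 12 + 4) + 4) + 2)
      (fun τ => (table τ).Complete c s) σ := by
  refine Halts.for (fun k τ => (table τ).Round c s k ∅) (by decide) ?_ ?_ ?_ ?_
  · exact fun τ hF => (hσ.of_frame hF (by decide) (by decide) (by decide)).numNodes_eval
  · exact CostFunction.Table.Round.zero (by simpa [table, State.setVar, write_apply] using hB)
  · intro k _ τ hF _ h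
    have hτ := hσ.of_frame hF (by decide) (by decide) (by decide)
    refine halts_forSteps (fun S τ => (table τ).Round c s k S) hnodup hmem hτ (by decide)
      (by decide) (by decide) ?_ h ?_ ?_
    · rintro S ρ a x (rfl | rfl) h <;> simpa [table, State.setVar, write_apply] using h
    · intro S e i t ρ he hq _ hi ht hF' hR
      refine (halts_relaxStep (hτ.of_frame hF' (by decide) (by decide) (by decide)) he hi ht
        hR.valid hq).mono le_rfl fun ρ' _ hρ' => ?_
      rw [hρ']
      exact hR.relax hc hq
    · intro ρ _ hR
      simpa [table, State.setVar, write_apply] using hR.next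
  · exact fun τ _ h => h.complete hc

end TemporalGraph

/-! ### Minimum costs and the list of tight steps -/

namespace TemporalGraph

open RAM RAM.Betweenness

variable {n : ℕ}
variable {G : TemporalGraph (Fin n)} {input : List (TimeArc (Fin n))} {c : G.CostFunction}
variable {s : Fin n} {σ τ : State (TimeArc (Fin n))} {p : Prog}

theorem halts_computeMinCosts (hmem : ∀ e, e ∈ input ↔ e ∈ G.arcs) (hσ : G.HasBases input σ)
    (h0 : ∀ z : Fin n, σ.cost 2 z = ⊤) :
    Halts input c.oracle computeMinCosts (input.length * 5 + 2)
      (fun τ => (table σ).IsMinCost G (τ.cost 2)) σ := by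
  refine Halts.for (k := 3) (fun i τ => (∀ e ∈ input.take i, τ.cost 2 e.dst ≤ σ.cost 0 (G.head e)) ∧
      ∀ z : Fin n, τ.cost 2 z = ⊤ ∨ ∃ e ∈ G.arcs, e.dst = z ∧ τ.cost 2 z = σ.cost 0 (G.head e))
    (by decide) ?_ ?_ ?_ ?_
  · intro τ hF
    exact (hσ.of_frame hF (by decide) (by decide) (by decide)).numArcs
  · simp [State.setVar, h0]
  · rintro i hi τ hF hc ⟨h1, h2⟩
    have hτ := hσ.of_frame hF (by decide) (by decide) (by decide)
    have hcost : τ.cost 0 = σ.cost 0 := hF.cost 0 (by decide)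
    obtain ⟨e, he⟩ : ∃ e, input[i]? = some e := ⟨_, List.getElem?_eq_getElem hi⟩
    have hea : e ∈ G.arcs := (hmem e).1 (List.mem_of_getElem? he)
    have htake : input.take (i + 1) = input.take i ++ [e] := by
      rw [List.take_add_one, he]; rfl
    have h3 : τ.idx 4 e.dst + e.time = G.head e := by
      rw [hτ.base _ e.dst.2.le]; simp [head, node]
    refine Halts.seq (k := 1) (l := 2) (Halts.setIdx (Halts.le (k := max 1 1 + 1) (by decide)
      (Halts.ite (fun h => ?_) fun h => ?_)))
    · replace h : σ.cost 0 (G.head e) < τ.cost 2 e.dst := by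
        simpa [Test.Holds, IdxExpr.eval, write_apply, hc, hτ.dst i e he, hτ.time i e he, h3, hcost]
          using h
      refine Halts.copyCost ?_
      simp only [State.setVar, IdxExpr.eval, write_apply, hc, hτ.dst i e he, hτ.time i e he, h3,
        hcost, htake]
      simp only [if_true, Function.update_self, Nat.reduceEqDiff, if_false, hc,
        hτ.dst i e he]
      refine ⟨fun f hf => ?_, fun z => ?_⟩
      · by_cases hfe : (f.dst : ℕ) = e.dst
        · rw [hfe, Function.update_self]
          rcases List.mem_append.1 hf with hf | hf
          · exact h.le.trans (hfe ▸ h1 f hf)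
          · simp at hf; rw [hf]
        · rw [Function.update_of_ne hfe]
          rcases List.mem_append.1 hf with hf | hf
          · exact h1 f hf
          · simp at hf; exact absurd (by rw [hf]) hfe
      · by_cases hz : z = e.dst
        · subst hz
          exact Or.inr ⟨e, hea, rfl, by rw [Function.update_self]⟩
        · rw [Function.update_of_ne (fun h => hz (Fin.ext h))]
          exact h2 z
    · replace h : τ.cost 2 e.dst ≤ σ.cost 0 (G.head e) := by
        simpa [Test.Holds, IdxExpr.eval, write_apply, hc, hτ.dst i e he, hτ.time i e he, h3, hcost]
          using h
      refine Halts.skip ⟨fun f hf => ?_, h2⟩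
      rw [htake] at hf
      rcases List.mem_append.1 hf with hf | hf
      · exact h1 f hf
      · simp at hf; rw [hf]; exact h
  · rintro τ - ⟨h1, h2⟩
    rw [List.take_length] at h1
    exact ⟨fun e he => h1 e ((hmem e).2 he), h2⟩

/-- The list of steps stored in the memory is `L`. -/
def Lists (G : TemporalGraph (Fin n)) (L : List (TimeArc (Fin n) × ℕ))
    (σ : State (TimeArc (Fin n))) : Prop :=
  σ.idx 9 0 = L.length ∧ ∀ j q, L[j]? = some q →
    σ.idx 6 j = G.tail q ∧ σ.idx 7 j = G.head q.1 ∧ σ.idx 8 j = q.1.dst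

theorem Lists.of_frame {L : List (TimeArc (Fin n) × ℕ)} (h : G.Lists L σ) (hF : Frame p σ τ)
    (hp : p.writes .idx 6 = false ∧ p.writes .idx 7 = false ∧ p.writes .idx 8 = false ∧
      p.writes .idx 9 = false) : G.Lists L τ := by
  unfold Lists
  rw [hF.idx 6 hp.1, hF.idx 7 hp.2.1, hF.idx 8 hp.2.2.1, hF.idx 9 hp.2.2.2]
  exact h

/-- The invariant of `listTightSteps`: the memory lists the tight steps in `S`, ordered by the
length of the stored walks at their tails. -/
def ListsTight (c : G.CostFunction) (B : CostFunction.Table n) (S : Set (TimeArc (Fin n) × ℕ))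
    (σ : State (TimeArc (Fin n))) : Prop :=
  ∃ L, G.Lists L σ ∧ L.Nodup ∧ (∀ q, q ∈ L ↔ q ∈ B.tight c ∧ q ∈ S) ∧
    L.Pairwise (fun q q' => B.len (G.tail q) ≤ B.len (G.tail q'))

theorem ListsTight.congr {B : CostFunction.Table n} {S S' : Set (TimeArc (Fin n) × ℕ)}
    (h : ListsTight c B S σ) (hS : ∀ q ∈ B.tight c, q ∈ S ↔ q ∈ S') : ListsTight c B S' σ := by
  obtain ⟨L, h1, h2, h3, h4⟩ := h
  exact ⟨L, h1, h2, fun q => (h3 q).trans (and_congr_right (hS q)), h4⟩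

theorem ListsTight.setVar {B : CostFunction.Table n} {S : Set (TimeArc (Fin n) × ℕ)} {a x : ℕ}
    (h : ListsTight c B S σ) (ha : 9 < a) : ListsTight c B S (σ.setVar a x) := by
  obtain ⟨L, h1, h2⟩ := h
  refine ⟨L, ?_, h2⟩
  unfold Lists
  rw [State.setVar_idx_of_ne _ _ _ _ (by omega), State.setVar_idx_of_ne _ _ _ _ (by omega),
    State.setVar_idx_of_ne _ _ _ _ (by omega), State.setVar_idx_of_ne _ _ _ _ (by omega)]
  exact h1

theorem halts_listStep {i t r : ℕ} {e : TimeArc (Fin n)} {S : Set (TimeArc (Fin n) × ℕ)}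
    (hσ : G.HasBases input σ)
    (he : input[i]? = some e) (hi : σ.idx 12 0 = i) (ht : σ.idx 13 0 = t) (hr : σ.idx 11 0 = r)
    (hB : (table σ).Valid c s) (hq : (e, t) ∈ G.steps)
    (hS : ∀ q ∈ S, (table σ).len (G.tail q) ≤ r + 1)
    (heS : (table σ).len (G.tail (e, t)) = r + 1 → (e, t) ∉ S)
    (hL : ListsTight c (table σ) S σ) :
    Halts input c.oracle listStep 11
      (fun τ => ListsTight c (table σ)
        (if (table σ).len (G.tail (e, t)) = r + 1 then insert (e, t) S else S) τ) σ := by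
  refine Halts.le (k := 2 + 9) (by decide) (Halts.seq ((halts_setStep hσ he hi ht).mono le_rfl ?_))
  rintro _ - rfl
  set σ' := (σ.setVar 16 (G.tail (e, t))).setVar 17 (G.head e) with hσ'
  have htab : table σ' = table σ := by simp [table, hσ', State.setVar, write_apply]
  have h16 : σ'.idx 16 0 = G.tail (e, t) := by simp [hσ', State.setVar, write_apply]
  have h17 : σ'.idx 17 0 = G.head e := by simp [hσ', State.setVar, write_apply]
  have h12 : σ'.idx 12 0 = i := by simp [hσ', State.setVar, write_apply, hi]
  have h11 : σ'.idx 11 0 = r := by simp [hσ', State.setVar, write_apply, hr]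
  have hdst : σ'.idx 2 i = e.dst := by
    simpa [hσ', State.setVar, write_apply] using hσ.dst i e he
  have hL' : ListsTight c (table σ) S σ' := (hL.setVar (by decide)).setVar (by decide)
  clear hL
  rw [← htab] at hB hS heS hL' ⊢
  clear_value σ'
  refine Halts.le (k := max 8 1 + 1) (by decide) (Halts.ite (fun h0 => ?_) fun h0 => ?_)
  · rw [Test.holds_eq] at h0
    replace h0 : σ'.idx 5 (G.tail (e, t)) = r + 1 := by
      simpa [IdxExpr.eval, h16, h11] using h0
    rw [if_pos (show (table σ').len (G.tail (e, t)) = r + 1 from h0)]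
    refine Halts.seq (k := 2) (l := 6)
      ((halts_queryCandidate (q := (e, t)) he h12 h16 hB hq (by omega)).mono le_rfl ?_)
    rintro ρ - ⟨h1, h2, h3, h4, h5⟩
    have hiff : (Test.and (.not (.costLt 0 (.var 17) 1 (.lit 0)))
        (.not (.costLt 1 (.lit 0) 0 (.var 17)))).Holds ρ ↔ (e, t) ∈ (table σ').tight c := by
      simp only [Test.Holds, IdxExpr.eval, h1, h2, h4, h17, not_lt, ← le_antisymm_iff]
      exact ⟨fun h => ⟨hq, by simp [table, h0], h⟩, fun h => h.2.2⟩
    obtain ⟨L, hLs, hnd, hLmem, hsorted⟩ := hL'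
    refine Halts.le (k := max 4 1 + 1) (by decide) (Halts.ite (fun h => ?_) fun h => ?_)
    · rw [hiff] at h
      refine Halts.seq (k := 1) (l := 3) (Halts.setIdx (Halts.seq (k := 1) (l := 2)
        (Halts.setIdx (Halts.seq (k := 1) (l := 1) (Halts.setIdx (Halts.setIdx
          ⟨L ++ [(e, t)], ⟨?_, ?_⟩, ?_, ?_, ?_⟩))))))
      · simp [write_apply, IdxExpr.eval, h1, hLs.1]
      · intro j q hj
        have hj' : j ≤ L.length := by
          by_contra hlt
          rw [List.getElem?_eq_none (by simp; omega)] at hj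
          cases hj
        rcases hj'.eq_or_lt with rfl | hlt
        · obtain rfl : (e, t) = q := by simpa using hj
          simp [write_apply, IdxExpr.eval, h1, hLs.1, h16, h17, h12, hdst]
        · rw [List.getElem?_append_left hlt] at hj
          simpa [write_apply, IdxExpr.eval, h1, hLs.1, hlt.ne] using hLs.2 j q hj
      · rw [List.nodup_append]
        refine ⟨hnd, by simp, fun a ha b hb => ?_⟩
        simp only [List.mem_singleton] at hb
        rintro rfl
        exact heS h0 (hb ▸ ((hLmem a).1 ha).2)
      · intro q
        rw [List.mem_append, hLmem, List.mem_singleton, Set.mem_insert_iff]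
        constructor
        · rintro (⟨h1, h2⟩ | rfl)
          · exact ⟨h1, Or.inr h2⟩
          · exact ⟨h, Or.inl rfl⟩
        · rintro ⟨h1, rfl | h2⟩
          · exact Or.inr rfl
          · exact Or.inl ⟨h1, h2⟩
      · rw [List.pairwise_append]
        refine ⟨hsorted, by simp, fun a ha b hb => ?_⟩
        simp only [List.mem_singleton] at hb
        rw [hb, show (table σ').len (G.tail (e, t)) = r + 1 from h0]
        exact hS a ((hLmem a).1 ha).2
    · rw [hiff] at h
      refine Halts.skip ⟨L, ?_, hnd, fun q => ?_, hsorted⟩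
      · unfold Lists; rw [h1]; exact hLs
      · rw [hLmem, Set.mem_insert_iff]
        refine and_congr_right fun hqt => ⟨Or.inr, fun h' => h'.resolve_left ?_⟩
        rintro rfl
        exact h hqt
  · rw [if_neg]
    · exact Halts.skip hL'
    · intro h
      refine h0 (Test.holds_eq.2 ?_)
      simpa [IdxExpr.eval, h16, h11, table] using h

theorem halts_listTightSteps (hc : c.Admissible) (hnodup : input.Nodup)
    (hmem : ∀ e, e ∈ input ↔ e ∈ G.arcs) (hσ : G.HasBases input σ)
    (hB : (table σ).Complete c s) :
    Halts input c.oracle listTightSteps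
      (n * (G.lifetime + 1) * (input.length * ((G.lifetime + 1) * 13 + 4) + 4) + 3)
      (fun τ => ∃ L, G.Lists L τ ∧ (table σ).Enumerates c s L) σ := by
  refine Halts.le (k := 1 + (n * (G.lifetime + 1) *
    (input.length * ((G.lifetime + 1) * 13 + 4) + 4) + 2)) (by omega)
    (Halts.seq (Halts.setIdx ?_))
  set σ₁ : State (TimeArc (Fin n)) := _
  change Halts _ _ _ _ _ σ₁
  have hσ₁ : G.HasBases input σ₁ := by
    obtain ⟨⟨h1, h2, h3, h4, h5, h6, h7, h8⟩, h9⟩ := hσ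
    constructor <;> try constructor
    all_goals simpa [σ₁, write_apply]
  have htab : table σ₁ = table σ := by simp [table, σ₁, write_apply]
  have h9 : σ₁.idx 9 0 = 0 := by simp [σ₁, write_apply, IdxExpr.eval]
  rw [← htab] at hB ⊢
  clear_value σ₁
  refine Halts.for (fun r τ => ListsTight c (table σ₁)
    {q | (table σ₁).len (G.tail q) ≤ r} τ) (by decide) ?_ ?_ ?_ ?_
  · exact fun τ hF => (hσ₁.of_frame hF (by decide) (by decide) (by decide)).numNodes_eval
  · refine ListsTight.setVar ⟨[], ⟨h9, by simp⟩, by simp, ?_, by simp⟩ (by decide)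
    intro q
    simp only [List.not_mem_nil, false_iff, not_and]
    rintro ⟨-, h, -⟩ h'
    simp at h'; omega
  · intro r _ τ hF hr h
    have hτ := hσ₁.of_frame hF (by decide) (by decide) (by decide)
    refine halts_forSteps (fun S τ => ListsTight c (table σ₁)
        {q | (table σ₁).len (G.tail q) ≤ r ∨ (table σ₁).len (G.tail q) = r + 1 ∧ q ∈ S} τ)
      hnodup hmem hτ (by decide) (by decide) (by decide) ?_ ?_ ?_ ?_
    · rintro S ρ a x (rfl | rfl) h <;> exact h.setVar (by decide)
    · exact h.congr (by simp)
    · intro S e i t ρ he hq hS hi ht hF' hR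
      have hρ : table ρ = table σ₁ :=
        (table_of_frame hF' (by decide) (by decide) (by decide)).trans
          (table_of_frame hF (by decide) (by decide) (by decide))
      rw [← hρ] at hR hB ⊢
      refine (halts_listStep (hτ.of_frame hF' (by decide) (by decide) (by decide)) he hi ht
        ((congrFun (hF'.idx 11 (by decide)) 0).trans hr) hB.valid hq ?_ ?_ hR).mono le_rfl ?_
      · rintro q (h | h)
        · exact h.trans (Nat.le_succ r)
        · exact h.1.le
      · rintro hlen (h | h)
        · exact absurd (hlen.symm.trans_le h) (by omega)
        · exact hS h.2
      · intro ρ' _ hρ'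
        refine hρ'.congr fun q _ => ?_
        split_ifs with hlen
        · simp only [Set.mem_insert_iff, Set.mem_ofPred_eq]
          constructor
          · rintro (rfl | h | h)
            · exact Or.inr ⟨hlen, Or.inl rfl⟩
            · exact Or.inl h
            · exact Or.inr ⟨h.1, Or.inr h.2⟩
          · rintro (h | ⟨h, rfl | h'⟩)
            · exact Or.inr (Or.inl h)
            · exact Or.inl rfl
            · exact Or.inr (Or.inr ⟨h, h'⟩)
        · simp only [Set.mem_insert_iff, Set.mem_ofPred_eq]
          constructor
          · rintro (h | h)
            · exact Or.inl h
            · exact Or.inr ⟨h.1, Or.inr h.2⟩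
          · rintro (h | ⟨h, rfl | h'⟩)
            · exact Or.inl h
            · exact absurd h hlen
            · exact Or.inr ⟨h, h'⟩
    · intro ρ _ hR
      refine ListsTight.setVar (hR.congr fun q hq => ?_) (by decide)
      have := hq.1
      simp only [Set.mem_ofPred_eq, this, and_true]
      omega
  · rintro τ _ ⟨L, h1, h2, h3, h4⟩
    exact ⟨L, h1, h2, fun q hq => ((h3 q).1 hq).1,
      fun q hq hg => (h3 q).2 ⟨hq, hB.len_tail_le hc hq hg⟩, h4⟩

theorem length_le_of_subset_steps {L : List (TimeArc (Fin n) × ℕ)} (hL : L.Nodup)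
    (h : ∀ q ∈ L, q ∈ G.steps) : L.length ≤ G.arcs.card * (G.lifetime + 1) := by
  classical
  rw [← List.toFinset_card_of_nodup hL, ← Finset.card_range (G.lifetime + 1),
    ← Finset.card_product]
  refine Finset.card_le_card fun q hq => ?_
  have h1 := h q (by simpa using hq)
  have h2 := G.time_le _ h1.1
  have h3 := h1.2
  simp only [Finset.mem_product, Finset.mem_range]
  exact ⟨h1.1, by omega⟩

end TemporalGraph

/-! ### Counting passes -/

namespace TemporalGraph

open RAM RAM.Betweenness

variable {n : ℕ}
variable {G : TemporalGraph (Fin n)} {input : List (TimeArc (Fin n))} {c : G.CostFunction}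
variable {s : Fin n} {σ τ : State (TimeArc (Fin n))} {p : Prog}
variable {L : List (TimeArc (Fin n) × ℕ)} {B : CostFunction.Table n}

/-- The rule for loops over the listed steps. -/
theorem halts_forListed {oracle : List (TimeArc (Fin n)) → WithTop ℝ → Prop} {k : ℕ}
    {Q : State (TimeArc (Fin n)) → Prop}
    (I : List (TimeArc (Fin n) × ℕ) → State (TimeArc (Fin n)) → Prop) (hL : G.Lists L σ)
    (hp : ∀ a, 6 ≤ a → a ≤ 9 → p.writes .idx a = false) (hp' : p.writes .idx 15 = false)
    (hI : ∀ L' τ x, I L' τ → I L' (τ.setVar 15 x)) (h0 : I [] σ)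
    (hs : ∀ L₁ q L₂, L = L₁ ++ q :: L₂ → ∀ τ j, τ.idx 15 0 = j → τ.idx 6 j = G.tail q →
      τ.idx 7 j = G.head q.1 → τ.idx 8 j = (q.1.dst : ℕ) → Frame (.for 15 (.var 9) p) σ τ → I L₁ τ →
      Halts input oracle p k (I (L₁ ++ [q])) τ)
    (hQ : ∀ τ, Frame (.for 15 (.var 9) p) σ τ → I L τ → Q τ) :
    Halts input oracle (.for 15 (.var 9) p) (L.length * (k + 2) + 2) Q σ := by
  have hw : ∀ a, 6 ≤ a → a ≤ 9 → (Prog.for 15 (.var 9) p).writes .idx a = false := by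
    intro a h1 h2
    have : a ≠ 15 := by omega
    simp [Prog.for, Prog.writes, hp a h1 h2, this]
  have hLτ : ∀ τ, Frame (.for 15 (.var 9) p) σ τ → G.Lists L τ := fun τ hF =>
    hL.of_frame hF ⟨hw _ (by decide) (by decide), hw _ (by decide) (by decide),
      hw _ (by decide) (by decide), hw _ (by decide) (by decide)⟩
  refine Halts.for (fun j τ => I (L.take j) τ) hp' (fun τ hF => (hLτ τ hF).1) (hI _ _ _ h0) ?_ ?_
  · intro j hj τ hF hc hIj
    obtain ⟨q, hq⟩ : ∃ q, L[j]? = some q := ⟨_, List.getElem?_eq_getElem hj⟩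
    obtain ⟨h6, h7, h8⟩ := (hLτ τ hF).2 j q hq
    have htake : L.take (j + 1) = L.take j ++ [q] := by
      rw [List.take_add_one, hq]; rfl
    refine (hs (L.take j) q (L.drop (j + 1)) ?_ τ j hc h6 h7 h8 hF hIj).mono le_rfl ?_
    · conv_lhs => rw [← List.take_append_drop (j + 1) L, htake]
      simp
    · intro τ' _ h
      rw [htake]
      exact hI _ _ _ h
  · intro τ hF h
    rw [List.take_length] at h
    exact hQ τ hF h

theorem halts_countWalks (hc : c.Admissible) (hB : B.Complete c s) (hE : B.Enumerates c s L)
    (hσ : G.HasBases input σ) (hL : G.Lists L σ) (hs : σ.idx 10 0 = s) (a : ℕ) {v : ℕ}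
    (hv : σ.idx 14 0 = v) :
    Halts input c.oracle (countWalks a) (L.length * 7 + 5)
      (fun τ => ∀ y, c.Good s y → τ.num a y = c.avoidCount s v y) σ := by
  refine Halts.le (k := (L.length * (1 + 2) + 2) + (1 + (L.length * (2 + 2) + 2))) (by omega)
    (Halts.seq ?_)
  refine halts_forListed (fun L' τ => ∀ q ∈ L', τ.num a (G.head q.1) = 0) hL
    (by intro b h1 h2; simp [Prog.writes]) rfl (fun _ _ _ h => h) (by simp) ?_ ?_
  · intro L₁ q L₂ _ τ j hj h6 h7 h8 _ hI
    refine Halts.setNum ?_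
    intro q' hq'
    simp only [IdxExpr.eval, NumExpr.eval, hj, h7, write_apply, if_true]
    by_cases h : G.head q'.1 = G.head q.1
    · rw [h, Function.update_self]
    · rw [Function.update_of_ne h]
      rcases List.mem_append.1 hq' with hq' | hq'
      · exact hI q' hq'
      · simp at hq'; exact absurd (by rw [hq']) h
  · intro τ hF h0
    have hτ : G.HasBases input τ := hσ.of_frame hF
      (by intro b hb; simp [Prog.writes, Prog.for]; omega) rfl rfl
    have hroot : IdxExpr.eval τ (.get 4 (.var 10)) = G.node s 0 := by
      simp [IdxExpr.eval, hF.idx 10 rfl, hs, hτ.base _ s.2.le]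
    refine Halts.seq (Halts.setNum ?_)
    set τ₁ : State (TimeArc (Fin n)) := _
    change Halts _ _ _ _ _ τ₁
    have hidx : τ₁.idx = τ.idx := rfl
    have hnum : τ₁.num a = Function.update (τ.num a) (G.node s 0) 1 := by
      simp [τ₁, write_apply, hroot, NumExpr.eval]
    have hL₁ : G.Lists L τ₁ := by
      unfold Lists
      rw [hidx]
      exact hL.of_frame hF ⟨rfl, rfl, rfl, rfl⟩
    refine halts_forListed (fun L' τ' => τ'.num a = L'.foldl (CostFunction.push G v) (τ₁.num a)) hL₁
      (by intro b h1 h2; simp [Prog.writes]) rfl (fun _ _ _ h => h) rfl ?_ ?_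
    · intro L₁ q L₂ _ ρ j hj h6 h7 h8 hF' hI
      have h14 : ρ.idx 14 0 = v := by
        rw [hF'.idx 14 rfl, hidx, hF.idx 14 rfl, hv]
      rw [List.foldl_append, ← hI]
      simp only [List.foldl_cons, List.foldl_nil, CostFunction.push]
      refine Halts.le (k := max 1 1 + 1) (by decide) (Halts.ite (fun h => ?_) fun h => ?_)
      · rw [Test.holds_eq] at h
        simp only [IdxExpr.eval, hj, h8, h14] at h
        rw [if_pos h]
        exact Halts.skip rfl
      · rw [Test.holds_eq] at h
        simp only [IdxExpr.eval, hj, h8, h14] at h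
        rw [if_neg h]
        refine Halts.setNum ?_
        simp [write_apply, IdxExpr.eval, NumExpr.eval, hj, h6, h7]
    · intro ρ _ h y hy
      rw [h]
      refine CostFunction.foldl_push hc hB hE v ?_ ?_ hy
      · rw [hnum, Function.update_self]
      · intro q hq
        rw [hnum, Function.update_of_ne (head_ne_root (hE.tight q hq).1.1), h0 q hq]

open Classical in
theorem halts_countByTarget (hc : c.Admissible) (hB : (table σ).Complete c s)
    (hE : (table σ).Enumerates c s L) (hm : (table σ).IsMinCost G (σ.cost 2))
    (hσ : G.HasBases input σ) (hL : G.Lists L σ) (h0 : ∀ z : Fin n, σ.num 3 z = 0) :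
    Halts input c.oracle countByTarget (L.length * 4 + 2)
      (fun τ => ∀ z : Fin n, τ.num 3 z = (L.map (fun q =>
        if G.head q.1 ∈ c.ends s ∧ q.1.dst = z then σ.num 1 (G.tail q) else 0)).sum) σ := by
  refine halts_forListed (k := 2) (fun L' τ => ∀ z : Fin n, τ.num 3 z = (L'.map (fun q =>
      if G.head q.1 ∈ c.ends s ∧ q.1.dst = z then σ.num 1 (G.tail q) else 0)).sum) hL
    (by intro b h1 h2; simp [Prog.writes]) rfl (fun _ _ _ h => h) (by simpa using h0) ?_
    (fun _ _ h => h)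
  intro L₁ q L₂ hLe τ j hj h6 h7 h8 hF hI
  have hqa : q.1 ∈ G.arcs := (hE.tight q (by simp [hLe])).1.1
  have hend : isEnd.Holds τ ↔ G.head q.1 ∈ c.ends s := by
    rw [← hB.mem_ends_iff hc hm hqa]
    simp [isEnd, Test.Holds, IdxExpr.eval, hj, h7, h8, hF.cost 2 (by decide),
      hF.cost 0 (by decide), hF.cost 3 (by decide), hσ.cost_top, table]
  have hone : τ.num 1 = σ.num 1 := hF.num 1 (by decide)
  refine Halts.le (k := max 1 1 + 1) (by decide) (Halts.ite (fun h => ?_) fun h => ?_)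
  · rw [hend] at h
    refine Halts.setNum fun z => ?_
    simp only [IdxExpr.eval, NumExpr.eval, hj, h6, h8, write_apply, if_true, List.map_append,
      List.sum_append, List.map_cons, List.map_nil, List.sum_singleton, h, true_and, hone]
    by_cases hz : q.1.dst = z
    · rw [hz, Function.update_self, hI z, if_pos rfl]
    · rw [Function.update_of_ne (fun h => hz (Fin.ext h.symm)), hI z, if_neg hz, add_zero]
  · rw [hend] at h
    refine Halts.skip fun z => ?_
    simp [h, hI z]

open Classical in
theorem halts_addDependencies (hc : c.Admissible) (hB : (table σ).Complete c s)
    (hE : (table σ).Enumerates c s L) (hm : (table σ).IsMinCost G (σ.cost 2))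
    (hσ : G.HasBases input σ) (hL : G.Lists L σ) {v : Fin n} (hv : σ.idx 14 0 = v) (hsv : s ≠ v)
    (hN : ∀ y, c.Good s y → σ.num 1 y = c.avoidCount s n y)
    (hN' : ∀ y, c.Good s y → σ.num 2 y = c.avoidCount s v y)
    (hS : ∀ z : Fin n, σ.num 3 z = (L.map (fun q =>
        if G.head q.1 ∈ c.ends s ∧ q.1.dst = z then σ.num 1 (G.tail q) else 0)).sum) :
    Halts input c.oracle addDependencies (L.length * 4 + 2)
      (fun τ => τ.num 0 = Function.update (σ.num 0) v (σ.num 0 v +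
        ∑ z, if v ≠ z then pairDependency c.optimalWalks s z v else 0)) σ := by
  refine halts_forListed (k := 2) (fun L' τ => τ.num 0 = Function.update (σ.num 0) v (σ.num 0 v +
      (L'.map (fun q => if G.head q.1 ∈ c.ends s ∧ q.1.dst ≠ v then
      (σ.num 1 (G.tail q) - σ.num 2 (G.tail q)) / σ.num 3 q.1.dst else 0)).sum)) hL
    (by intro b h1 h2; simp [Prog.writes]) rfl (fun _ _ _ h => h) (by simp) ?_ ?_
  · intro L₁ q L₂ hLe τ j hj h6 h7 h8 hF hI
    have hqa : q.1 ∈ G.arcs := (hE.tight q (by simp [hLe])).1.1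
    have h14 : τ.idx 14 0 = v := by rw [hF.idx 14 (by decide), hv]
    have hend : (Test.and isEnd (.not (.eq (.get 8 (.var 15)) (.var 14)))).Holds τ ↔
        (G.head q.1 ∈ c.ends s ∧ q.1.dst ≠ v) := by
      rw [← hB.mem_ends_iff hc hm hqa]
      refine and_congr ?_ ?_
      · simp [isEnd, Test.Holds, IdxExpr.eval, hj, h7, h8, hF.cost 2 (by decide),
          hF.cost 0 (by decide), hF.cost 3 (by decide), hσ.cost_top, table]
      · simp only [Test.Holds, Test.holds_eq, IdxExpr.eval, hj, h8, h14, Fin.val_inj, ne_eq]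
    refine Halts.le (k := max 1 1 + 1) (by decide) (Halts.ite (fun h => ?_) fun h => ?_)
    · rw [hend] at h
      refine Halts.setNum ?_
      simp [IdxExpr.eval, NumExpr.eval, hj, h6, h8, h14, write_apply, hI, h, hF.num 1 (by decide),
        hF.num 2 (by decide), hF.num 3 (by decide), add_assoc]
    · rw [hend] at h
      refine Halts.skip ?_
      rw [hI, List.map_append, List.sum_append, List.map_singleton, List.sum_singleton, if_neg h,
        add_zero]
  · intro τ _ h
    rw [h, CostFunction.sum_pairDependency hc hB hE hsv hN hN' hS]

open Classical in
/-- The contribution of the source `s` to the betweenness of `v`. -/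
noncomputable def contribution (c : G.CostFunction) (s v : Fin n) : ℚ :=
  ∑ z, if s ≠ v ∧ v ≠ z then pairDependency c.optimalWalks s z v else 0

open Classical in
theorem halts_allVertices (hc : c.Admissible) (hB : (table σ).Complete c s)
    (hE : (table σ).Enumerates c s L) (hm : (table σ).IsMinCost G (σ.cost 2))
    (hσ : G.HasBases input σ) (hL : G.Lists L σ) (hs : σ.idx 10 0 = s)
    (hN : ∀ y, c.Good s y → σ.num 1 y = c.avoidCount s n y)
    (hS : ∀ z : Fin n, σ.num 3 z = (L.map (fun q =>
        if G.head q.1 ∈ c.ends s ∧ q.1.dst = z then σ.num 1 (G.tail q) else 0)).sum) :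
    Halts input c.oracle allVertices (n * (L.length * 11 + 10) + 2)
      (fun τ => ∀ v : Fin n, τ.num 0 v = σ.num 0 v + contribution c s v) σ := by
  refine Halts.for (k := L.length * 11 + 8) (fun i τ => ∀ w : Fin n, τ.num 0 w = σ.num 0 w +
    if (w : ℕ) < i then contribution c s w else 0) (by decide) ?_ (by simp [State.setVar]) ?_ ?_
  · intro τ hF
    exact (hσ.of_frame hF (by decide) (by decide) (by decide)).numVertices
  · intro i hi τ hF hv hI
    have h10 : τ.idx 10 0 = s := by rw [hF.idx 10 (by decide), hs]
    refine Halts.le (k := max 1 ((L.length * 7 + 5) + (L.length * 4 + 2)) + 1) (by omega)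
      (Halts.ite (fun h => ?_) fun h => ?_)
    · rw [Test.holds_eq] at h
      simp only [IdxExpr.eval, hv, h10] at h
      refine Halts.skip fun w => ?_
      rw [State.setVar_num, hI w]
      congr 1
      by_cases hw : (w : ℕ) = i
      · have hsw : s = w := Fin.ext (by omega)
        simp [contribution, hsw]
      · exact if_congr (by omega) rfl rfl
    · rw [Test.holds_eq] at h
      simp only [IdxExpr.eval, hv, h10] at h
      have hτ := hσ.of_frame hF (by decide) (by decide) (by decide)
      have hLτ := hL.of_frame hF (by decide)
      have htab : table τ = table σ := table_of_frame hF (by decide) (by decide) (by decide)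
      refine Halts.seq ((halts_countWalks hc hB hE hτ hLτ h10 2 hv).mono le_rfl ?_)
      intro ρ hF' hρ
      have hF₁ : Frame allVertices σ ρ := hF.trans (hF'.of_writes_le (by
        intro b a hw
        cases b <;> simp_all [Prog.writes, Prog.for]))
      have htab' : table ρ = table σ := table_of_frame hF₁ (by decide) (by decide) (by decide)
      have h1 : ρ.num 1 = σ.num 1 := hF₁.num 1 (by decide)
      have h3 : ρ.num 3 = σ.num 3 := hF₁.num 3 (by decide)
      have h2 : ρ.cost 2 = σ.cost 2 := hF₁.cost 2 (by decide)
      have hnum0 : ρ.num 0 = τ.num 0 := hF'.num 0 (by decide)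
      have hsv : s ≠ ⟨i, hi⟩ := by
        rintro rfl
        exact h rfl
      refine (halts_addDependencies (v := ⟨i, hi⟩) hc (htab'.symm ▸ hB) (htab'.symm ▸ hE)
        (htab'.symm ▸ h2.symm ▸ hm) (hσ.of_frame hF₁ (by decide) (by decide) (by decide))
        (hL.of_frame hF₁ (by decide)) ?_ hsv (h1.symm ▸ hN) hρ (h1.symm ▸ h3.symm ▸ hS)).mono
        le_rfl ?_
      · rw [hF'.idx 14 (by decide), hv]
      · intro ρ' _ h' w
        rw [State.setVar_num, h', hnum0]
        by_cases hw : w = ⟨i, hi⟩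
        · subst hw
          have hIi := hI ⟨i, hi⟩
          simp only [lt_irrefl, if_false, add_zero] at hIi
          simp [Function.update_self, hIi, contribution, hsv]
        · have hw' : (w : ℕ) ≠ i := fun h => hw (Fin.ext h)
          rw [Function.update_of_ne (by simpa using hw'), hI w]
          congr 1
          exact if_congr (by omega) rfl rfl
  · intro τ _ h v
    simpa using h v

end TemporalGraph

/-! ### The whole program -/

namespace TemporalGraph

open RAM RAM.Betweenness

variable {n : ℕ}
variable {G : TemporalGraph (Fin n)} {input : List (TimeArc (Fin n))} {c : G.CostFunction}
variable {s : Fin n} {σ τ : State (TimeArc (Fin n))}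

theorem halts_resetTable (hσ : G.HasBases input σ) (hs : σ.idx 10 0 = s)
    (h0 : ∀ y, n * (G.lifetime + 1) ≤ y → σ.idx 5 y = 0) :
    Halts input c.oracle resetTable (n * (G.lifetime + 1) * 4 + 4)
      (fun τ => (table τ).Valid c s) σ := by
  refine Halts.le (k := (n * (G.lifetime + 1) * (2 + 2) + 2) + (1 + 1)) (by omega) (Halts.seq ?_)
  refine Halts.for (fun i τ => ∀ y, (y < i → τ.cost 0 y = ⊤) ∧
    (y < i ∨ n * (G.lifetime + 1) ≤ y → τ.idx 5 y = 0)) (by decide) ?_ ?_ ?_ ?_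
  · exact fun τ hF => (hσ.of_frame hF (by decide) (by decide) (by decide)).numNodes_eval
  · intro y
    simpa [State.setVar, write_apply] using h0 y
  · intro i _ τ hF hi hI
    have hτ := hσ.of_frame hF (by decide) (by decide) (by decide)
    refine Halts.seq (k := 1) (l := 1) (Halts.setIdx (Halts.copyCost ?_))
    intro y
    obtain ⟨h1, h2⟩ := hI y
    simp only [State.setVar, write_apply, IdxExpr.eval, hi, hτ.cost_top, Nat.reduceEqDiff, if_true,
      if_false]
    by_cases hy : y = i
    · subst hy; simp
    · rw [Function.update_of_ne hy, Function.update_of_ne hy]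
      exact ⟨fun h => h1 (by omega), fun h => h2 (by omega)⟩
  · intro τ hF hI
    have hτ := hσ.of_frame hF (by decide) (by decide) (by decide)
    have h10 : τ.idx 10 0 = s := by rw [hF.idx 10 (by decide), hs]
    have hroot : τ.idx 4 s = G.node s 0 := hτ.base _ s.2.le
    have hlen : ∀ y, τ.idx 5 y = 0 := fun y => (hI y).2 (lt_or_ge _ _)
    refine Halts.seq (Halts.setIdx (Halts.copyWalk ?_))
    have htab : ∀ ρ : State (TimeArc (Fin n)),
        ρ.idx 5 = Function.update (τ.idx 5) (G.node s 0) 1 → ρ.cost 0 = τ.cost 0 →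
        ρ.walk 0 (G.node s 0) = [] → (table ρ).Valid c s := by
      intro ρ h5 hc hw
      have hpos : ∀ y, 0 < ρ.idx 5 y → y = G.node s 0 := by
        intro y hy
        by_contra hne
        rw [h5, Function.update_of_ne hne, hlen] at hy
        exact lt_irrefl _ hy
      have hone : ρ.idx 5 (G.node s 0) = 1 := by rw [h5, Function.update_self]
      refine ⟨hone, ?_, ?_, ?_, ?_, fun y hy _ => ?_⟩
      · intro y hy; rw [hpos y hy]; simpa [table, hw] using isPath_nil
      · intro y hy; rw [hpos y hy]; simp [table, hw, endNode_nil]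
      · intro y hy; rw [hpos y hy]; simp [table, hw, hone]
      · intro y hy hne; exact absurd (hpos y hy) hne
      · exact (congrFun hc y).trans ((hI y).1 hy)
    refine htab _ ?_ ?_ ?_
    · simp [write_apply, IdxExpr.eval, h10, hroot]
    · simp
    · simp [write_apply, IdxExpr.eval, h10, hroot, hτ.walk_nil]

theorem halts_resetTargets (hσ : G.HasBases input σ) :
    Halts input c.oracle resetTargets (n * 4 + 2)
      (fun τ => ∀ z : Fin n, τ.cost 2 z = ⊤ ∧ τ.num 3 z = 0) σ := by
  refine Halts.for (k := 2) (fun i τ => ∀ z < i, τ.cost 2 z = ⊤ ∧ τ.num 3 z = 0) (by decide)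
    ?_ (by simp) ?_ (fun τ _ h z => h z z.2)
  · exact fun τ hF => (hσ.of_frame hF (by decide) (by decide) (by decide)).numVertices
  · intro i _ τ hF hi hI
    have hτ := hσ.of_frame hF (by decide) (by decide) (by decide)
    refine Halts.seq (k := 1) (l := 1) (Halts.copyCost (Halts.setNum ?_))
    intro z hz
    simp only [State.setVar, write_apply, IdxExpr.eval, NumExpr.eval, hi, hτ.cost_top, if_true]
    by_cases hzi : z = i
    · subst hzi; simp
    · rw [Function.update_of_ne hzi, Function.update_of_ne hzi]
      exact hI z (by omega)

/-- The summands of the time bound belong to the nine commands of `oneSource`, in their order. -/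
theorem halts_oneSource (hc : c.Admissible) (hnodup : input.Nodup)
    (hmem : ∀ e, e ∈ input ↔ e ∈ G.arcs) (hσ : G.HasBases input σ) (hs : σ.idx 10 0 = s)
    (h0 : ∀ y, n * (G.lifetime + 1) ≤ y → σ.idx 5 y = 0) {k : ℕ} (hk :
      n * (G.lifetime + 1) * 4 + 4 + (n * 4 + 2 +
      (n * (G.lifetime + 1) * (input.length * ((G.lifetime + 1) * 12 + 4) + 4) + 2 +
      (input.length * 5 + 2 +
      (n * (G.lifetime + 1) * (input.length * ((G.lifetime + 1) * 13 + 4) + 4) + 3 + (1 +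
      (G.arcs.card * (G.lifetime + 1) * 7 + 5 + (G.arcs.card * (G.lifetime + 1) * 4 + 2 +
      (n * (G.arcs.card * (G.lifetime + 1) * 11 + 10) + 2)))))))) ≤ k) :
    Halts input c.oracle oneSource k (fun τ =>
      (∀ v : Fin n, τ.num 0 v = σ.num 0 v + contribution c s v) ∧
      ∀ y, n * (G.lifetime + 1) ≤ y → τ.idx 5 y = 0) σ := by
  refine Halts.le hk ?_
  refine Halts.seq ((halts_resetTable hσ hs h0).mono le_rfl fun σ₁ hF₁ hB₁ => ?_)
  have hσ₁ := hσ.of_frame hF₁ (by decide) (by decide) (by decide)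
  refine Halts.seq ((halts_resetTargets hσ₁).mono le_rfl fun σ₂ hF₂ h₂ => ?_)
  have hσ₂ := hσ₁.of_frame hF₂ (by decide) (by decide) (by decide)
  have hB₂ : (table σ₂).Valid c s := by
    rwa [table_of_frame hF₂ (by decide) (by decide) (by decide)]
  refine Halts.seq ((halts_relaxAll hc hnodup hmem hσ₂ hB₂).mono le_rfl fun σ₃ hF₃ hB₃ => ?_)
  have hσ₃ := hσ₂.of_frame hF₃ (by decide) (by decide) (by decide)
  refine Halts.seq ((halts_computeMinCosts hmem hσ₃ ?_).mono le_rfl fun σ₄ hF₄ hm₄ => ?_)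
  · intro z
    rw [hF₃.cost 2 (by decide)]
    exact (h₂ z).1
  have hσ₄ := hσ₃.of_frame hF₄ (by decide) (by decide) (by decide)
  have hB₄ : (table σ₄).Complete c s := by
    rwa [table_of_frame hF₄ (by decide) (by decide) (by decide)]
  rw [← table_of_frame hF₄ (by decide) (by decide) (by decide)] at hm₄
  refine Halts.seq ((halts_listTightSteps hc hnodup hmem hσ₄ hB₄).mono le_rfl
    fun σ₅ hF₅ ⟨L, hL₅, hE⟩ => ?_)
  have hσ₅ := hσ₄.of_frame hF₅ (by decide) (by decide) (by decide)
  have htab₅ : table σ₅ = table σ₄ := table_of_frame hF₅ (by decide) (by decide) (by decide)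
  have hlen := length_le_of_subset_steps hE.nodup fun q hq => (hE.tight q hq).1
  have h14 : Halts input c.oracle (.setIdx 14 (.lit 0) (.get 0 (.lit 0))) 1
      (fun τ => τ.idx 14 0 = n) σ₅ := by
    refine Halts.setIdx ?_
    simp [write_apply, IdxExpr.eval, hσ₅.numVertices]
  refine Halts.seq (h14.mono le_rfl fun σ₆ hF₆ hv₆ => ?_)
  have hσ₆ := hσ₅.of_frame hF₆ (by decide) (by decide) (by decide)
  have hs₆ : σ₆.idx 10 0 = s := by
    rw [hF₆.idx 10 (by decide), hF₅.idx 10 (by decide), hF₄.idx 10 (by decide),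
      hF₃.idx 10 (by decide), hF₂.idx 10 (by decide), hF₁.idx 10 (by decide), hs]
  have htab₆ : table σ₆ = table σ₄ :=
    (table_of_frame hF₆ (by decide) (by decide) (by decide)).trans htab₅
  refine Halts.seq ((halts_countWalks hc hB₄ hE hσ₆ (hL₅.of_frame hF₆ (by decide)) hs₆ 1 hv₆).mono
    (by omega) fun σ₇ hF₇ hN₇ => ?_)
  have hσ₇ := hσ₆.of_frame hF₇ (by decide) (by decide) (by decide)
  have hL₇ : G.Lists L σ₇ := (hL₅.of_frame hF₆ (by decide)).of_frame hF₇ (by decide)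
  have htab₇ : table σ₇ = table σ₄ :=
    (table_of_frame hF₇ (by decide) (by decide) (by decide)).trans htab₆
  have hcost₇ : σ₇.cost 2 = σ₄.cost 2 := by
    rw [hF₇.cost 2 (by decide), hF₆.cost 2 (by decide), hF₅.cost 2 (by decide)]
  refine Halts.seq ((halts_countByTarget hc (htab₇.symm ▸ hB₄) (htab₇.symm ▸ hE)
    (htab₇.symm ▸ hcost₇.symm ▸ hm₄) hσ₇ hL₇ ?_).mono (by omega) fun σ₈ hF₈ hS₈ => ?_)
  · intro z
    rw [hF₇.num 3 (by decide), hF₆.num 3 (by decide), hF₅.num 3 (by decide),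
      hF₄.num 3 (by decide), hF₃.num 3 (by decide)]
    exact (h₂ z).2
  have htab₈ : table σ₈ = table σ₄ :=
    (table_of_frame hF₈ (by decide) (by decide) (by decide)).trans htab₇
  have hcost₈ : σ₈.cost 2 = σ₄.cost 2 := by rw [hF₈.cost 2 (by decide), hcost₇]
  have hnum₈ : σ₈.num 1 = σ₇.num 1 := hF₈.num 1 (by decide)
  refine (halts_allVertices hc (htab₈.symm ▸ hB₄) (htab₈.symm ▸ hE)
    (htab₈.symm ▸ hcost₈.symm ▸ hm₄) (hσ₇.of_frame hF₈ (by decide) (by decide) (by decide))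
    (hL₇.of_frame hF₈ (by decide)) ?_ (hnum₈.symm ▸ hN₇) (hnum₈.symm ▸ hS₈)).mono ?_
    fun σ₉ hF₉ h₉ => ⟨fun v => ?_, fun y hy => ?_⟩
  · rw [hF₈.idx 10 (by decide), hF₇.idx 10 (by decide), hs₆]
  · gcongr
  · rw [h₉, hF₈.num 0 (by decide), hF₇.num 0 (by decide), hF₆.num 0 (by decide),
      hF₅.num 0 (by decide), hF₄.num 0 (by decide), hF₃.num 0 (by decide), hF₂.num 0 (by decide),
      hF₁.num 0 (by decide)]
  · have htab₉ : table σ₉ = table σ₄ :=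
      (table_of_frame hF₉ (by decide) (by decide) (by decide)).trans htab₈
    have hval : (table σ₉).Valid c s := htab₉ ▸ hB₄.valid
    -- stored walks end at valid codes
    by_contra hne
    have hpos : 0 < (table σ₉).len y := Nat.pos_of_ne_zero hne
    have := (hval.isPath y hpos).endNode_lt
    rw [hval.endNode_eq y hpos] at this
    omega

theorem hasInput_initialState :
    G.HasInput input (initialState n G.lifetime input) := by
  refine ⟨by simp [initialState], by simp [initialState], by simp [initialState], ?_, ?_, ?_,
    fun _ => rfl, fun _ => rfl⟩
  all_goals
    intro i e he
    simp [initialState, he]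

theorem halts_computeBases (hσ : G.HasInput input σ) (h0 : σ.idx 4 0 = 0) :
    Halts input c.oracle computeBases (n * 3 + 2) (fun τ => G.HasBases input τ) σ := by
  refine Halts.for (k := 1) (fun i τ => ∀ v ≤ i, τ.idx 4 v = G.node v 0) (by decide) ?_ ?_ ?_ ?_
  · exact fun τ hF => (hσ.of_frame hF (by decide) (by decide) (by decide)).numVertices
  · intro v hv
    obtain rfl : v = 0 := by omega
    simp [State.setVar, write_apply, h0, node]
  · intro i _ τ hF hi hI
    have hτ := hσ.of_frame hF (by decide) (by decide) (by decide)
    refine Halts.setIdx ?_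
    intro v hv
    simp only [State.setVar, write_apply, IdxExpr.eval, hi, hτ.lifetime, if_true, if_false,
      Nat.reduceEqDiff]
    by_cases hvi : v = i + 1
    · rw [hvi, Function.update_self, hI i le_rfl]
      simp only [node]; ring
    · rw [Function.update_of_ne hvi]
      exact hI v (by omega)
  · exact fun τ hF h => ⟨hσ.of_frame hF (by decide) (by decide) (by decide), h⟩

theorem betweenness_eq_sum_contribution (v : Fin n) :
    betweenness c.optimalWalks v = ∑ s, contribution c s v := by
  refine Finset.sum_congr rfl fun s _ => Finset.sum_congr rfl fun z _ => ?_
  split_ifs <;> rfl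

theorem betweenness_eq_zero (h : G.arcs = ∅) (v : Fin n) : betweenness c.optimalWalks v = 0 := by
  have hno : IsEmpty G.Walk := ⟨fun W => by
    have := W.mem_arcs _ (List.getLast_mem W.ne_nil)
    simp [h] at this⟩
  have hcount : ∀ s z, walkCount c.optimalWalks s z = 0 := by
    intro s z
    rw [walkCount, Set.eq_empty_of_isEmpty {W | W ∈ c.optimalWalks ∧ W.IsFromTo s z},
      Set.ncard_empty]
  simp [betweenness, pairDependency, hcount]

/-- The time spent on one source is at most a constant times `n * M * T ^ 2`. -/
theorem oneSource_bound {n M T : ℕ} (hn : 1 ≤ n) (hM : 1 ≤ M) (hT : 1 ≤ T) :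
    n * (T + 1) * 4 + 4 + (n * 4 + 2 + (n * (T + 1) * (M * ((T + 1) * 12 + 4) + 4) + 2 +
      (M * 5 + 2 + (n * (T + 1) * (M * ((T + 1) * 13 + 4) + 4) + 3 + (1 +
      (M * (T + 1) * 7 + 5 + (M * (T + 1) * 4 + 2 +
      (n * (M * (T + 1) * 11 + 10) + 2)))))))) ≤ 300 * (n * M * T ^ 2) := by
  have hT1 : T + 1 ≤ 2 * T := by omega
  have hTT : T ≤ T ^ 2 := Nat.le_self_pow two_ne_zero T
  have hX : 1 ≤ n * M * T ^ 2 := Nat.mul_pos (Nat.mul_pos hn hM) (pow_pos hT 2)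
  have h1 : n * (T + 1) * (M * (T + 1)) ≤ 4 * (n * M * T ^ 2) :=
    (Nat.mul_le_mul (Nat.mul_le_mul_left n hT1) (Nat.mul_le_mul_left M hT1)).trans
      (le_of_eq (by ring))
  have h2 : n * (T + 1) * M ≤ 2 * (n * M * T ^ 2) :=
    calc n * (T + 1) * M ≤ n * (2 * T ^ 2) * M := by gcongr; omega
      _ = _ := by ring
  have h3 : n * (T + 1) ≤ n * (T + 1) * M := Nat.le_mul_of_pos_right _ hM
  have h4 : n ≤ n * (T + 1) := Nat.le_mul_of_pos_right _ (by omega)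
  have h5 : M * (T + 1) ≤ n * (T + 1) * M := by
    calc M * (T + 1) ≤ n * (M * (T + 1)) := Nat.le_mul_of_pos_left _ hn
      _ = _ := by ring
  have h6 : M ≤ M * (T + 1) := Nat.le_mul_of_pos_right _ (by omega)
  have e1 : n * (T + 1) * (M * ((T + 1) * 12 + 4) + 4) =
      12 * (n * (T + 1) * (M * (T + 1))) + 4 * (n * (T + 1) * M) + 4 * (n * (T + 1)) := by ring
  have e2 : n * (T + 1) * (M * ((T + 1) * 13 + 4) + 4) =
      13 * (n * (T + 1) * (M * (T + 1))) + 4 * (n * (T + 1) * M) + 4 * (n * (T + 1)) := by ring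
  have e3 : n * (M * (T + 1) * 11 + 10) = 11 * (n * (T + 1) * M) + 10 * n := by ring
  rw [e1, e2, e3]
  omega

theorem halts_main (hc : c.Admissible) (hnodup : input.Nodup)
    (hmem : ∀ e, e ∈ input ↔ e ∈ G.arcs) :
    Halts input c.oracle main (400 * (n ^ 2 * G.arcs.card * G.lifetime ^ 2 + 1))
      (fun τ => ∀ v : Fin n, τ.num 0 v = betweenness c.optimalWalks v)
      (initialState n G.lifetime input) := by
  classical
  have hcard : input.length = G.arcs.card := by
    rw [← List.toFinset_card_of_nodup hnodup]
    congr 1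
    ext e
    simp [hmem]
  have hin : G.HasInput input (initialState n G.lifetime input) := hasInput_initialState
  rcases Nat.eq_zero_or_pos input.length with hM | hM
  · refine Halts.le (k := max 0 1 + 1) (by omega) (Halts.ite (fun h => ?_) fun _ => ?_)
    · simp [Test.Holds, IdxExpr.eval, hin.numArcs, hM] at h
    · refine Halts.skip fun v => ?_
      rw [betweenness_eq_zero (Finset.card_eq_zero.1 (hcard ▸ hM))]
      rfl
  · obtain ⟨e, he⟩ := Finset.card_pos.1 (hcard ▸ hM)
    have hn : 1 ≤ n := (Nat.zero_le _).trans_lt e.src.2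
    have hT : 1 ≤ G.lifetime := (G.time_pos e he).trans (G.time_le e he)
    set X := n * G.arcs.card * G.lifetime ^ 2 with hX
    have hbound : max ((n * 3 + 2) + (n * (300 * X + 2) + 2)) 1 + 1 ≤
        400 * (n ^ 2 * G.arcs.card * G.lifetime ^ 2 + 1) := by
      have h1 : n ^ 2 * G.arcs.card * G.lifetime ^ 2 = n * X := by rw [hX]; ring
      have h2 : n ≤ n * X := Nat.le_mul_of_pos_right _
        (Nat.mul_pos (Nat.mul_pos hn (hcard ▸ hM)) (pow_pos hT 2))
      have h3 : n * (300 * X + 2) = 300 * (n * X) + 2 * n := by ring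
      rw [h1, h3]
      omega
    refine Halts.le hbound (Halts.ite (fun _ => ?_) fun h => ?_)
    · refine Halts.seq ((halts_computeBases hin rfl).mono le_rfl fun σ hF hσ => ?_)
      refine Halts.for (fun i τ => (∀ v : Fin n, τ.num 0 v =
          ∑ s : Fin n, if (s : ℕ) < i then contribution c s v else 0) ∧
          ∀ y, n * (G.lifetime + 1) ≤ y → τ.idx 5 y = 0) (by decide) ?_ ⟨?_, ?_⟩ ?_ ?_
      · exact fun τ hF => (hσ.of_frame hF (by decide) (by decide) (by decide)).numVertices
      · intro v
        simp [State.setVar, hF.num 0 (by decide), initialState]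
      · intro y _
        simp [State.setVar, write_apply, hF.idx 5 (by decide), initialState]
      · intro i hi τ hF' hs hI
        refine (halts_oneSource (s := ⟨i, hi⟩) hc hnodup hmem
          (hσ.of_frame hF' (by decide) (by decide) (by decide)) hs hI.2
          (by rw [hcard]; exact oneSource_bound hn (hcard ▸ hM) hT)).mono le_rfl ?_
        rintro ρ - ⟨h1, h2⟩
        refine ⟨fun v => ?_, fun y hy => ?_⟩
        · rw [State.setVar_num, h1 v, hI.1 v]
          have hsplit : ∀ s : Fin n, (if (s : ℕ) < i + 1 then contribution c s v else 0) =
              (if (s : ℕ) < i then contribution c s v else 0) +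
                if s = ⟨i, hi⟩ then contribution c s v else 0 := by
            intro s
            rcases lt_trichotomy (s : ℕ) i with h | h | h
            · have : s ≠ ⟨i, hi⟩ := fun h' => h.ne (congrArg Fin.val h')
              simp [h, this, Nat.lt_succ_of_lt h]
            · obtain rfl : s = ⟨i, hi⟩ := Fin.ext h
              simp
            · have : s ≠ ⟨i, hi⟩ := fun h' => h.ne' (congrArg Fin.val h')
              rw [if_neg (by omega), if_neg (by omega), if_neg this, add_zero]
          rw [Finset.sum_congr rfl fun s _ => hsplit s, Finset.sum_add_distrib]
          simp
        · simpa [State.setVar, write_apply] using h2 y hy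
      · intro τ _ h v
        rw [h.1 v, betweenness_eq_sum_contribution]
        exact Finset.sum_congr rfl fun s _ => if_pos s.2
    · exact absurd (by simpa [Test.Holds, IdxExpr.eval, hin.numArcs] using hM) h

end TemporalGraph

theorem mainTheorem1 :
    ∃ (prog : RAM.Prog) (K : ℕ),
      ∀ (n : ℕ) (G : TemporalGraph (Fin n)) (input : List (TimeArc (Fin n)))
        (c : G.CostFunction),
        input.Nodup → (∀ e, e ∈ input ↔ e ∈ G.arcs) →
        c.HasMinima → c.IsFinite → c.PrefixCompatible →
          ∃ (steps : ℕ) (final : RAM.State (TimeArc (Fin n))),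
            RAM.Run input c.oracle prog (RAM.initialState n G.lifetime input) steps final ∧
            steps ≤ K * (n ^ 2 * G.arcs.card * G.lifetime ^ 2 + 1) ∧
            ∀ v : Fin n, final.num 0 v = TemporalGraph.betweenness c.optimalWalks v := by
  refine ⟨RAM.Betweenness.main, 400, fun n G input c hnodup hmem hm hf hp => ?_⟩
  obtain ⟨k, hk, final, hrun, hfinal⟩ :=
    TemporalGraph.halts_main (c := c) ⟨hm, hf, hp⟩ hnodup hmem
  exact ⟨k, final, hrun, hk, hfinal⟩
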